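/- **Stress-energy-momentum tensor for electromagnetic fluids.** Let $\mathcal M$ be a smooth oriented $(n+1)$-dimensional manifold, $n\ge 2$, with a Lorentzian metric $\mathsf g$ of signature $(-,+,\dots,+)$ and volume form $\mu(\mathsf g)$; let $c>0$ and $q\in\mathbb R$. Let $\ell(A,F,w,\varrho,\varsigma)$ be a fluid Lagrangian density (for the given metric $\mathsf g$), i.e. a fibre-preserving map whose arguments are a one-form $A$, a 2-form $F$, a vector $w$ and two $(n+1)$-forms $\varrho,\varsigma$, and whose value is an $(n+1)$-form. Let $A,F,w,\varrho,\varsigma$ be such fields on a region $\mathcal N\subset\mathcal M$, with $w$ timelike ($F={\rm d}A$ is the case of interest). Put $$u=\frac{c\,w}{\sqrt{-\mathsf g(w,w)}},\quad \rho=\frac{\sqrt{-\mathsf g(w,w)}\,\varrho}{c\,\mu(\mathsf g)},\quad s=\frac{\sqrt{-\mathsf g(w,w)}\,\varsigma}{c\,\mu(\mathsf g)},\quad E=-\tfrac1c\,\mathbf i_uF,\quad B=-\tfrac1c\,\mathbf i_u(\star F)\in\Omega^{n-2},$$ and $\mathsf P=\delta+\frac1{c^2}u\otimes u^\flat$. Here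 $(\star\omega)_{j_1\dots j_l}=\frac1{k!}\omega^{i_1\dots i_k}\mu(\mathsf g)_{i_1\dots i_kj_1\dots j_l}$ for a $k$-form $\omega$, $k+l=n+1$. Derivatives with respect to $k$-forms are regarded as $k$-vectors through $\pi:\omega=\frac1{k!}\pi^{i_1\dots i_k}\omega_{i_1\dots i_k}$, and $(\pi\stackrel{\rm tr}{\otimes}\omega)^\mu{}_\nu=\frac1{(k-1)!}\pi^{\mu\gamma_2\dots\gamma_k}\omega_{\nu\gamma_2\dots\gamma_k}$ (zero if $k=0$). The stress-energy-momentum tensor of $\ell$ is the $(1,1)$-tensor density $$\mathfrak T=\ell\,\delta-\sum_{\kappa\in\{A,F,w,\varrho,\varsigma\}}\frac{\partial\ell}{\partial\kappa}\therefore\widehat\kappa ,$$ where $\widehat\kappa$ is the algebraic part of the Lie derivative, $\pounds_\zeta\kappa=\nabla_\zeta\kappa+\widehat\kappa:\nabla\zeta$ ($\nabla$ torsion free), and $\therefore$ contracts all indices except the two that $\nabla\zeta$ is paired with. **(i)** At every point of $\mathcal N$ at which $\ell$ is differentiable, $$\mathfrak T=\Big(\ell-\varrho\frac{\partial\ell}{\partial\varrho}-\varsigma\frac{\partial\ell}{\partial\varsigma}\Big)\delta+w\otimes\frac{\partial\ell}{\partial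 w}-\frac{\partial\ell}{\partial A}\otimes A-\frac{\partial\ell}{\partial F}\stackrel{\rm tr}{\otimes}F .$$ **(ii)** Let $\epsilon(\rho,s,E,B,\mathsf g)$ be a covariant energy density: for all $x,y\in\mathcal M$, all linear isomorphisms $L:T_x\mathcal M\to T_y\mathcal M$, all $\rho,s\in\mathbb R$, and all one-forms $E$, $(n-2)$-forms $B$ and Lorentzian metrics $h$ on $T_y\mathcal M$, $\epsilon(\rho,s,L^*E,L^*B,L^*h)=\epsilon(\rho,s,E,B,h)$. If $\ell=-\epsilon(\rho,s,E,B,\mathsf g)\,\mu(\mathsf g)-q\rho\,A\cdot u\,\mu(\mathsf g)$ over $\mathcal N$ for all arguments $(A,F,w,\varrho,\varsigma)$ with $w$ timelike, then at every point of $\mathcal N$ at which $\epsilon$ is differentiable in $(\rho,s,E,B)$, $\ell$ is differentiable and $$\begin{aligned}\mathfrak T=\Big[&\Big(\epsilon-\frac{\partial\epsilon}{\partial E}\cdot E\Big)\frac1{c^2}u\otimes u^\flat+\frac1c\big(u\otimes S_\epsilon+S_\epsilon^\sharp\otimes u^\flat\big)+\frac{\partial\epsilon}{\partial E}\otimes E-B^\sharp\stackrel{\rm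 tr}{\otimes}\Big(\frac{\partial\epsilon}{\partial B}\Big)^\flat\\&+\Big(\rho\frac{\partial\epsilon}{\partial\rho}+s\frac{\partial\epsilon}{\partial s}+\frac{\partial\epsilon}{\partial B}:B-\epsilon\Big)\mathsf P\Big]\mu(\mathsf g),\end{aligned}$$ with the Poynting one-form $S_\epsilon=(-1)^n\frac1c\,\mathbf i_{E^\sharp}\mathbf i_u\star\big(\frac{\partial\epsilon}{\partial B}\big)^\flat$. **(iii)** If $\ell=-\mathfrak e(\rho,s,u,F,\mathsf g)\,\mu(\mathsf g)-q\rho\,A\cdot u\,\mu(\mathsf g)$ over $\mathcal N$ for all arguments $(A,F,w,\varrho,\varsigma)$ with $w$ timelike, then at every point of $\mathcal N$ at which $\mathfrak e$ is differentiable in $(\rho,s,u,F)$, $\ell$ is differentiable and $$\mathfrak T=\Big[\Big(\mathfrak e-\frac{\partial\mathfrak e}{\partial u}\cdot u\Big)\frac1{c^2}u\otimes u^\flat-u\otimes\frac{\partial\mathfrak e}{\partial u}+\frac{\partial\mathfrak e}{\partial F}\stackrel{\rm tr}{\otimes}F+\Big(\rho\frac{\partial\mathfrak e}{\partial\rho}+s\frac{\partial\mathfrak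 e}{\partial s}-\mathfrak e\Big)\mathsf P\Big]\mu(\mathsf g).$$ -/

import Mathlib

open scoped Manifold

noncomputable section

namespace EMFluid

/-! ### Linear algebra of one tangent space

`V` is a finite-dimensional real vector space (a tangent space of spacetime). -/

section Fibre

variable {V : Type*} [AddCommGroup V] [Module ℝ V] [TopologicalSpace V]

/-- Covectors. -/
abbrev Covec (V : Type*) [AddCommGroup V] [Module ℝ V] [TopologicalSpace V] : Type _ :=
  V →L[ℝ] ℝ

/-- Alternating `k`-forms. -/
abbrev Form (V : Type*) [AddCommGroup V] [Module ℝ V] [TopologicalSpace V] (k : ℕ) : Type _ :=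
  V [⋀^Fin k]→L[ℝ] ℝ

/-- Covariant 2-tensors; `g v` is the covector `v♭ = g(v, ·)`. -/
abbrev Bilin (V : Type*) [AddCommGroup V] [Module ℝ V] [TopologicalSpace V] : Type _ :=
  V →L[ℝ] V →L[ℝ] ℝ

/-- `g` is a Lorentzian metric of signature `(-, +, …, +)`: it is symmetric, and it is positive
definite on the `g`-orthogonal complement of some vector `t` with `g(t,t) < 0`. -/
def IsLorentzian (g : Bilin V) : Prop :=
  (∀ v w, g v w = g w v) ∧
    ∃ t, g t t < 0 ∧ ∀ v, g t v = 0 → v ≠ 0 → 0 < g v v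

/-- The vector `α♯`: inverse of `v ↦ g(v, ·)`. -/
def sharp (g : Bilin V) : Covec V →L[ℝ] V := ContinuousLinearMap.inverse g

/-- The alternating form on `ℝ^k` given by the determinant. -/
def detForm (k : ℕ) : (Fin k → ℝ) [⋀^Fin k]→L[ℝ] ℝ :=
  { (Matrix.detRowAlternating : (Fin k → ℝ) [⋀^Fin k]→ₗ[ℝ] ℝ) with
    cont := by
      change Continuous fun M : Matrix (Fin k) (Fin k) ℝ => M.det
      exact continuous_id.matrix_det }

/-- `α₁ ∧ … ∧ α_k`, that is `(x₁, …, x_k) ↦ det (α_i(x_j))`. -/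
def wedge {k : ℕ} (α : Fin k → Covec V) : Form V k :=
  (detForm k).compContinuousLinearMap (ContinuousLinearMap.pi α)

/-- Interior product `i_v ω = ω(v, ·, …, ·)`. -/
def interior {k : ℕ} (v : V) (ω : Form V (k + 1)) : Form V k :=
  { ω.toAlternatingMap.curryLeft v with
    cont := ω.cont.comp (continuous_const.matrixVecCons continuous_id) }

theorem interior_apply {k : ℕ} (v : V) (ω : Form V (k + 1)) (x : Fin k → V) :
    interior v ω x = ω (Matrix.vecCons v x) := rfl

/-- The infinitesimal pull-back action of an endomorphism `X` on `k`-forms,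
`(X · ω)(x₁, …, x_k) = ∑_j ω(x₁, …, X x_j, …, x_k)`.  With `X = ∇ζ` this is the algebraic term
`ω̂ : ∇ζ` of the Lie derivative `£_ζ ω = ∇_ζ ω + ω̂ : ∇ζ`. -/
def act {k : ℕ} (X : V →L[ℝ] V) (ω : Form V k) : Form V k where
  toFun x := ∑ j, ω (Function.update x j (X (x j)))
  map_update_add' := by
    intro inst x i a b
    obtain rfl : inst = instDecidableEqFin k := Subsingleton.elim _ _
    rw [← Finset.sum_add_distrib]
    refine Finset.sum_congr rfl fun j _ => ?_
    by_cases h : j = i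
    · subst h
      simp
    · have h' : i ≠ j := fun e => h e.symm
      simp only [Function.update_of_ne h]
      rw [Function.update_comm h', Function.update_comm h', Function.update_comm h']
      exact ω.map_update_add _ _ _ _
  map_update_smul' := by
    intro inst x i a b
    obtain rfl : inst = instDecidableEqFin k := Subsingleton.elim _ _
    rw [smul_eq_mul, Finset.mul_sum]
    refine Finset.sum_congr rfl fun j _ => ?_
    by_cases h : j = i
    · subst h
      simp
    · have h' : i ≠ j := fun e => h e.symm
      simp only [Function.update_of_ne h]
      rw [Function.update_comm h', Function.update_comm h']
      exact ω.map_update_smul _ _ _ _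
  map_eq_zero_of_eq' := by
    intro x a b hab hne
    have hne' : b ≠ a := fun e => hne e.symm
    have key : ω (Function.update x a (X (x a))) + ω (Function.update x b (X (x b))) = 0 := by
      have h := ω.toAlternatingMap.map_swap (Function.update x a (X (x a))) hne
      have e : Function.update x a (X (x a)) ∘ Equiv.swap a b =
          Function.update x b (X (x b)) := by
        funext i
        by_cases h1 : i = a
        · subst h1
          simp [Function.update_of_ne hne, Function.update_of_ne hne', hab]
        · by_cases h2 : i = b
          · subst h2
            simp [hab]
          · simp [Equiv.swap_apply_of_ne_of_ne h1 h2, h1, h2]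
      rw [e] at h
      change ω (Function.update x b (X (x b))) = - ω (Function.update x a (X (x a))) at h
      rw [h]
      ring
    have hsub : ∑ j, ω (Function.update x j (X (x j))) =
        ∑ j ∈ {a, b}, ω (Function.update x j (X (x j))) := by
      refine (Finset.sum_subset (Finset.subset_univ _) ?_).symm
      intro j _ hj
      simp only [Finset.mem_insert, Finset.mem_singleton, not_or] at hj
      refine ω.map_eq_zero_of_eq _ (i := a) (j := b) ?_ hne
      rw [Function.update_of_ne (fun e => hj.1 e.symm), Function.update_of_ne (fun e => hj.2 e.symm),
        hab]
    change ∑ j, ω (Function.update x j (X (x j))) = 0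
    rw [hsub, Finset.sum_pair hne, key]
  cont := by
    change Continuous fun x : Fin k → V => ∑ j, ω (Function.update x j (X (x j)))
    refine continuous_finsetSum _ fun j _ => ω.cont.comp ?_
    exact continuous_id.update j (X.continuous.comp (continuous_apply j))

variable [IsTopologicalAddGroup V] [ContinuousSMul ℝ V] [T2Space V] [FiniteDimensional ℝ V]

/-- A basis `e_i` of `V`; all the constructions below that use it are independent of it. -/
def frame (V : Type*) [AddCommGroup V] [Module ℝ V] [FiniteDimensional ℝ V] :
    Module.Basis (Fin (Module.finrank ℝ V)) ℝ V := Module.finBasis ℝ V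

/-- The covectors `e^i` dual to a basis `e_i`. -/
def dualVec {ι : Type*} (e : Module.Basis ι ℝ V) (i : ι) : Covec V :=
  LinearMap.toContinuousLinearMap (e.coord i)

/-- The volume form `μ(g) = √|det g_{ij}| e^1 ∧ … ∧ e^d` of `g` for the orientation `o`, computed in
a positively oriented basis. -/
def volForm {d : ℕ} (g : Bilin V) (o : Orientation ℝ V (Fin d)) : Form V d :=
  open Classical in
  if h : ∃ e : Module.Basis (Fin d) ℝ V, e.orientation = o then
    √|(Matrix.of fun i j => g (h.choose i) (h.choose j)).det| • wedge (dualVec h.choose)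
  else 0

/-- The quotient `ϱ / μ` of two top-degree forms: the number `r` with `ϱ = r μ`. -/
def topRatio {d : ℕ} (ϱ μ : Form V d) : ℝ :=
  open Classical in if h : ∃ r : ℝ, ϱ = r • μ then h.choose else 0

/-- The Hodge star of a `k`-form, for the metric `g` and the volume form `μ`, with `k + l = d`:
`(⋆ω)_{j₁…j_l} = (1/k!) ω^{i₁…i_k} μ_{i₁…i_k j₁…j_l}`. -/
def hodge {k l d : ℕ} (h : k + l = d) (g : Bilin V) (μ : Form V d) (ω : Form V k) : Form V l :=
  ((k.factorial : ℝ)⁻¹ * (l.factorial : ℝ)⁻¹) •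
    ∑ i : Fin k → Fin (Module.finrank ℝ V), ∑ j : Fin l → Fin (Module.finrank ℝ V),
      (ω (fun a => sharp g (dualVec (frame V) (i a))) *
        μ (fun a => Fin.append (fun b => frame V (i b)) (fun b => frame V (j b))
          (Fin.cast h.symm a))) •
      wedge (fun b => dualVec (frame V) (j b))

/-- `ω♯`, the `k`-vector obtained from a `k`-form by raising all indices.  A `k`-vector `π` is
represented by its pairing `ω ↦ π : ω = (1/k!) π^{i₁…i_k} ω_{i₁…i_k}` with `k`-forms. -/
def sharpForm {k : ℕ} (g : Bilin V) (ω : Form V k) (χ : Form V k) : ℝ :=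
  (k.factorial : ℝ)⁻¹ *
    ∑ i : Fin k → Fin (Module.finrank ℝ V),
      ω (fun a => sharp g (dualVec (frame V) (i a))) * χ (fun a => frame V (i a))

/-- `π♭`, the `k`-form obtained from a `k`-vector by lowering all indices,
`π♭(x₁, …, x_k) = π : (x₁♭ ∧ … ∧ x_k♭)`. -/
def flatVec {k : ℕ} (g : Bilin V) (π : Form V k → ℝ) : Form V k :=
  (k.factorial : ℝ)⁻¹ •
    ∑ i : Fin k → Fin (Module.finrank ℝ V),
      π (wedge fun a => g (frame V (i a))) • wedge (fun a => dualVec (frame V) (i a))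

/-- The `(1,1)` tensor `π ⊗^tr ω` of a `k`-vector `π` (possibly with values in densities) and a
`k`-form `ω`, `(π ⊗^tr ω)^μ_ν = (1/(k-1)!) π^{μ γ₂…γ_k} ω_{ν γ₂…γ_k}`, as the bilinear map
`(α, v) ↦ α_μ (π ⊗^tr ω)^μ_ν v^ν`.  It is zero if `k = 0`. -/
def trTensor {W : Type*} [AddCommGroup W] [Module ℝ W] :
    {k : ℕ} → (π : Form V k → W) → (ω : Form V k) → Covec V → V → W
  | 0, _, _, _, _ => 0
  | k + 1, π, ω, α, v =>
      (k.factorial : ℝ)⁻¹ •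
        ∑ i : Fin k → Fin (Module.finrank ℝ V),
          ω (Matrix.vecCons v fun a => frame V (i a)) •
            π (wedge (Matrix.vecCons α fun a => dualVec (frame V) (i a)))

end Fibre

/-! ### The fluid variables at one point -/

section Fluid

variable {V : Type*} [AddCommGroup V] [Module ℝ V] [TopologicalSpace V]
  [IsTopologicalAddGroup V] [ContinuousSMul ℝ V] [T2Space V] [FiniteDimensional ℝ V]

/-- `√(-g(w,w))`. -/
def speed (g : Bilin V) (w : V) : ℝ := √(-(g w w))

/-- The world-velocity `u = c w / √(-g(w,w))`. -/
def worldVel (c : ℝ) (g : Bilin V) (w : V) : V := (c / speed g w) • w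

/-- The proper density `√(-g(w,w)) ϱ / (c μ(g))` of a generalized density `ϱ`. -/
def proper {d : ℕ} (c : ℝ) (g : Bilin V) (μ : Form V d) (w : V) (ϱ : Form V d) : ℝ :=
  speed g w / c * topRatio ϱ μ

/-- The electric field `E = -(1/c) i_u F`. -/
def elec (c : ℝ) (u : V) (F : Form V 2) : Covec V :=
  -(1 / c) • (ContinuousAlternatingMap.ofSubsingleton ℝ V ℝ (0 : Fin 1)).symm (interior u F)

/-- The magnetic field `B = -(1/c) i_u ⋆F`, an `(n-2)`-form; here `n = m + 2` is the dimension of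
space, so that spacetime has dimension `n + 1 = m + 3`. -/
def magn {m : ℕ} (c : ℝ) (g : Bilin V) (μ : Form V (m + 3)) (u : V) (F : Form V 2) : Form V m :=
  -(1 / c) • interior u (hodge (k := 2) (l := m + 1) (by omega) g μ F)

/-- The projection tensor `P = δ + (1/c²) u ⊗ u♭`, as `(α, v) ↦ α_μ P^μ_ν v^ν`. -/
def proj (c : ℝ) (g : Bilin V) (u : V) (α : Covec V) (v : V) : ℝ :=
  α v + 1 / c ^ 2 * (α u * g u v)

/-- A fluid Lagrangian density `ℓ(A, F, w, ϱ, ς)` at one point (with the metric fixed); `d` is the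
dimension of spacetime. -/
abbrev Lagr (V : Type*) [AddCommGroup V] [Module ℝ V] [TopologicalSpace V] (d : ℕ) : Type _ :=
  Covec V → Form V 2 → V → Form V d → Form V d → Form V d

/-- `ℓ` is jointly differentiable in its five arguments at `(A, F, w, ϱ, ς)`. -/
def LagrDiff {d : ℕ} (ℓ : Lagr V d) (A : Covec V) (F : Form V 2) (w : V) (ϱ ς : Form V d) : Prop :=
  DifferentiableAt ℝ
    (fun p : Covec V × Form V 2 × V × Form V d × Form V d =>
      ℓ p.1 p.2.1 p.2.2.1 p.2.2.2.1 p.2.2.2.2) (A, F, w, ϱ, ς)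

/-! Partial derivatives, as linear maps on variations: for instance
`dA ℓ … δA = δA · ∂ℓ/∂A` and `dF ℓ … δF = δF : ∂ℓ/∂F = ½ δF_{μν} (∂ℓ/∂F)^{μν}`. -/

def dA {d : ℕ} (ℓ : Lagr V d) (A : Covec V) (F : Form V 2) (w : V) (ϱ ς : Form V d) :
    Covec V →L[ℝ] Form V d := fderiv ℝ (fun A' => ℓ A' F w ϱ ς) A

def dF {d : ℕ} (ℓ : Lagr V d) (A : Covec V) (F : Form V 2) (w : V) (ϱ ς : Form V d) :
    Form V 2 →L[ℝ] Form V d := fderiv ℝ (fun F' => ℓ A F' w ϱ ς) F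

def dw {d : ℕ} (ℓ : Lagr V d) (A : Covec V) (F : Form V 2) (w : V) (ϱ ς : Form V d) :
    V →L[ℝ] Form V d := fderiv ℝ (fun w' => ℓ A F w' ϱ ς) w

def dRho {d : ℕ} (ℓ : Lagr V d) (A : Covec V) (F : Form V 2) (w : V) (ϱ ς : Form V d) :
    Form V d →L[ℝ] Form V d := fderiv ℝ (fun ϱ' => ℓ A F w ϱ' ς) ϱ

def dSigma {d : ℕ} (ℓ : Lagr V d) (A : Covec V) (F : Form V 2) (w : V) (ϱ ς : Form V d) :
    Form V d →L[ℝ] Form V d := fderiv ℝ (fun ς' => ℓ A F w ϱ ς') ς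

/-- The stress-energy-momentum tensor
`𝔗 = ℓ δ - ∑_κ ∂ℓ/∂κ ∴ κ̂`, the sum being over the transported fields `κ = A, F, w, ϱ, ς`.
It is a `(1,1)` tensor density, given as the map `(α, v) ↦ α_μ 𝔗^μ_ν v^ν`.  For `X = v ⊗ α`,
`α_μ (π ∴ κ̂)^μ_ν v^ν = π : (κ̂ : X)`, where `κ̂ : X` is the algebraic term of the Lie derivative
`£_ζ κ = ∇_ζ κ + κ̂ : ∇ζ` for `∇ζ = X`; for a vector `ŵ : X = -X w`, for a covector `Â : X = A ∘ X`,
and for a form `κ̂ : X = act X κ`. -/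
def sem {d : ℕ} (ℓ : Lagr V d) (A : Covec V) (F : Form V 2) (w : V) (ϱ ς : Form V d)
    (α : Covec V) (v : V) : Form V d :=
  let X : V →L[ℝ] V := α.smulRight v
  α v • ℓ A F w ϱ ς
    - dw ℓ A F w ϱ ς (-(X w))
    - dRho ℓ A F w ϱ ς (act X ϱ)
    - dSigma ℓ A F w ϱ ς (act X ς)
    - dA ℓ A F w ϱ ς (A.comp X)
    - dF ℓ A F w ϱ ς (act X F)

/-- First form:
`(ℓ - ϱ ∂ℓ/∂ϱ - ς ∂ℓ/∂ς) δ + w ⊗ ∂ℓ/∂w - ∂ℓ/∂A ⊗ A - ∂ℓ/∂F ⊗^tr F`. -/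
def semTransported {d : ℕ} (ℓ : Lagr V d) (A : Covec V) (F : Form V 2) (w : V) (ϱ ς : Form V d)
    (α : Covec V) (v : V) : Form V d :=
  α v • (ℓ A F w ϱ ς - dRho ℓ A F w ϱ ς ϱ - dSigma ℓ A F w ϱ ς ς)
    + α w • dw ℓ A F w ϱ ς v
    - A v • dA ℓ A F w ϱ ς α
    - trTensor (dF ℓ A F w ϱ ς) F α v

/-- An energy density `ε(ρ, s, E, B, g)` at one point. -/
abbrev Energy (V : Type*) [AddCommGroup V] [Module ℝ V] [TopologicalSpace V] (m : ℕ) : Type _ :=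
  ℝ → ℝ → Covec V → Form V m → Bilin V → ℝ

/-- `ε(·, ·, ·, ·, g)` is jointly differentiable at `(ρ, s, E, B)`. -/
def EnergyDiff {m : ℕ} (ε : Energy V m) (g : Bilin V) (ρ s : ℝ) (E : Covec V) (B : Form V m) :
    Prop :=
  DifferentiableAt ℝ (fun p : ℝ × ℝ × Covec V × Form V m => ε p.1 p.2.1 p.2.2.1 p.2.2.2 g)
    (ρ, s, E, B)

/-- `ℓ(A, F, w, ϱ, ς) = -ε(ρ, s, E, B, g) μ(g) - q ρ A(u) μ(g)` for all arguments with `w` timelike,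
where `u, ρ, s, E, B` are computed from `(F, w, ϱ, ς)`. -/
def ExpressedByEnergy {m : ℕ} (c q : ℝ) (g : Bilin V) (μ : Form V (m + 3)) (ℓ : Lagr V (m + 3))
    (ε : Energy V m) : Prop :=
  ∀ (A : Covec V) (F : Form V 2) (w : V) (ϱ ς : Form V (m + 3)), g w w < 0 →
    ℓ A F w ϱ ς =
      -(ε (proper c g μ w ϱ) (proper c g μ w ς) (elec c (worldVel c g w) F)
          (magn c g μ (worldVel c g w) F) g) • μ
        - (q * proper c g μ w ϱ * A (worldVel c g w)) • μ

/-- The Poynting one-form `S_ε = (-1)^n (1/c) i_{E♯} i_u ⋆(∂ε/∂B)♭`, with `n = m + 2` and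
`b = ∂ε/∂B`. -/
def poynting {m : ℕ} (c : ℝ) (g : Bilin V) (μ : Form V (m + 3)) (u : V) (E : Covec V)
    (b : Form V m → ℝ) : Covec V :=
  ((-1 : ℝ) ^ (m + 2) * (1 / c)) • (ContinuousAlternatingMap.ofSubsingleton ℝ V ℝ (0 : Fin 1)).symm
    (interior (sharp g E) (interior u (hodge (k := m) (l := 3) rfl g μ (flatVec g b))))

/-- Second form:
`[(ε - ∂ε/∂E · E) (1/c²) u ⊗ u♭ + (1/c) (u ⊗ S_ε + S_ε♯ ⊗ u♭) + ∂ε/∂E ⊗ E - B♯ ⊗^tr (∂ε/∂B)♭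
  + (ρ ∂ε/∂ρ + s ∂ε/∂s + ∂ε/∂B : B - ε) P] μ(g)`. -/
def semElecMagn {m : ℕ} (c : ℝ) (g : Bilin V) (μ : Form V (m + 3)) (ε : Energy V m)
    (ρ s : ℝ) (u : V) (E : Covec V) (B : Form V m) (α : Covec V) (v : V) : Form V (m + 3) :=
  let ε₀ : ℝ := ε ρ s E B g
  let ερ : ℝ := deriv (fun ρ' => ε ρ' s E B g) ρ
  let εs : ℝ := deriv (fun s' => ε ρ s' E B g) s
  let εE : Covec V →L[ℝ] ℝ := fderiv ℝ (fun E' => ε ρ s E' B g) E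
  let εB : Form V m →L[ℝ] ℝ := fderiv ℝ (fun B' => ε ρ s E B' g) B
  let S : Covec V := poynting c g μ u E εB
  ((ε₀ - εE E) * (1 / c ^ 2 * (α u * g u v))
    + 1 / c * (α u * S v + α (sharp g S) * g u v)
    + εE α * E v
    - trTensor (sharpForm g B) (flatVec g εB) α v
    + (ρ * ερ + s * εs + εB B - ε₀) * proj c g u α v) • μ

/-- An energy density `𝔢(ρ, s, u, F, g)` at one point. -/
abbrev FaradayEnergy (V : Type*) [AddCommGroup V] [Module ℝ V] [TopologicalSpace V] : Type _ :=
  ℝ → ℝ → V → Form V 2 → Bilin V → ℝ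

/-- `𝔢(·, ·, ·, ·, g)` is jointly differentiable at `(ρ, s, u, F)`. -/
def FaradayEnergyDiff (e : FaradayEnergy V) (g : Bilin V) (ρ s : ℝ) (u : V) (F : Form V 2) :
    Prop :=
  DifferentiableAt ℝ (fun p : ℝ × ℝ × V × Form V 2 => e p.1 p.2.1 p.2.2.1 p.2.2.2 g)
    (ρ, s, u, F)

/-- `ℓ(A, F, w, ϱ, ς) = -𝔢(ρ, s, u, F, g) μ(g) - q ρ A(u) μ(g)` for all arguments with `w` timelike,
where `u, ρ, s` are computed from `(w, ϱ, ς)`. -/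
def ExpressedByFaraday {d : ℕ} (c q : ℝ) (g : Bilin V) (μ : Form V d) (ℓ : Lagr V d)
    (e : FaradayEnergy V) : Prop :=
  ∀ (A : Covec V) (F : Form V 2) (w : V) (ϱ ς : Form V d), g w w < 0 →
    ℓ A F w ϱ ς =
      -(e (proper c g μ w ϱ) (proper c g μ w ς) (worldVel c g w) F g) • μ
        - (q * proper c g μ w ϱ * A (worldVel c g w)) • μ

/-- Third form:
`[(𝔢 - ∂𝔢/∂u · u) (1/c²) u ⊗ u♭ - u ⊗ ∂𝔢/∂u + ∂𝔢/∂F ⊗^tr F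
  + (ρ ∂𝔢/∂ρ + s ∂𝔢/∂s - 𝔢) P] μ(g)`. -/
def semFaraday {d : ℕ} (c : ℝ) (g : Bilin V) (μ : Form V d) (e : FaradayEnergy V)
    (ρ s : ℝ) (u : V) (F : Form V 2) (α : Covec V) (v : V) : Form V d :=
  let e₀ : ℝ := e ρ s u F g
  let eρ : ℝ := deriv (fun ρ' => e ρ' s u F g) ρ
  let es : ℝ := deriv (fun s' => e ρ s' u F g) s
  let eu : V →L[ℝ] ℝ := fderiv ℝ (fun u' => e ρ s u' F g) u
  let eF : Form V 2 →L[ℝ] ℝ := fderiv ℝ (fun F' => e ρ s u F' g) F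
  ((e₀ - eu u) * (1 / c ^ 2 * (α u * g u v))
    - α u * eu v
    + trTensor eF F α v
    + (ρ * eρ + s * es - e₀) * proj c g u α v) • μ

end Fluid

/-! ### Spacetime -/

section Spacetime

variable {E : Type*} [NormedAddCommGroup E] [NormedSpace ℝ E] [FiniteDimensional ℝ E]
  {M : Type*} [TopologicalSpace M] [ChartedSpace E M]

instance instT2TangentSpace (x : M) : T2Space (TangentSpace 𝓘(ℝ, E) x) :=
  inferInstanceAs (T2Space E)

instance instFiniteDimensionalTangentSpace (x : M) :
    FiniteDimensional ℝ (TangentSpace 𝓘(ℝ, E) x) :=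
  inferInstanceAs (FiniteDimensional ℝ E)

/-- Pull-back of a covariant 2-tensor by a linear map. -/
def pullBilin {V W : Type*} [AddCommGroup V] [Module ℝ V] [TopologicalSpace V]
    [AddCommGroup W] [Module ℝ W] [TopologicalSpace W]
    (L : V →L[ℝ] W) (g : Bilin W) : Bilin V :=
  (ContinuousLinearMap.precomp ℝ L).comp (g.comp L)

theorem pullBilin_apply {V W : Type*} [AddCommGroup V] [Module ℝ V] [TopologicalSpace V]
    [AddCommGroup W] [Module ℝ W] [TopologicalSpace W]
    (L : V →L[ℝ] W) (g : Bilin W) (v w : V) : pullBilin L g v w = g (L v) (L w) := rfl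

/-- Covariance of an energy density on spacetime: it is unchanged when all its tensor arguments are
pulled back by the differential `L : T_xM → T_yM` of a (local) diffeomorphism with `x ↦ y`,
`ε(ρ, s, L^*E, L^*B, L^*h) = ε(ρ, s, E, B, h)` for every Lorentzian `h`. -/
def IsCovariant {m : ℕ} (ε : ∀ x : M, Energy (TangentSpace 𝓘(ℝ, E) x) m) : Prop :=
  ∀ (x y : M) (L : TangentSpace 𝓘(ℝ, E) x ≃L[ℝ] TangentSpace 𝓘(ℝ, E) y) (ρ s : ℝ)
    (e : Covec (TangentSpace 𝓘(ℝ, E) y)) (b : Form (TangentSpace 𝓘(ℝ, E) y) m)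
    (h : Bilin (TangentSpace 𝓘(ℝ, E) y)), IsLorentzian h →
      ε x ρ s (e.comp (L : TangentSpace 𝓘(ℝ, E) x →L[ℝ] TangentSpace 𝓘(ℝ, E) y))
        (b.compContinuousLinearMap (L : TangentSpace 𝓘(ℝ, E) x →L[ℝ] TangentSpace 𝓘(ℝ, E) y))
        (pullBilin (L : TangentSpace 𝓘(ℝ, E) x →L[ℝ] TangentSpace 𝓘(ℝ, E) y) h) =
      ε y ρ s e b h

end Spacetime

end EMFluid

end

open EMFluid

/-!
The statement is pointwise, so everything happens in one tangent space `V`, with `α` a covector, `v`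
a vector and `X = v ⊗ α`.

*Transported variables.* The algebraic part of the Lie derivative acts on a top-degree form as the
trace of `X` (`act_top`), on a covector by `A ∘ X = A(v) α` (`act_covec`), and on a `k`-form by
`X · ω = α ∧ i_v ω`, whose contraction with a linear `π` is `π ⊗^tr ω` (`trTensor_eq_act`).  The first
form follows by linearity of the partial derivatives (`sem_eq_semTransported`).

*The energy in terms of the 2-form.* Near a timelike `w` the maps `w ↦ √(-g(w,w))`, `w ↦ u` and
`(w, ϱ) ↦ ρ` are differentiable, and the chain rule gives the partial derivatives of `ℓ`
(`lagrDiff_of_faraday`, `sem_of_faraday`); the charge terms cancel, because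
`q ρ A(u) μ(g) = q A(w) ϱ`.

*The energy in terms of the electric and the magnetic field.* Such an energy is an energy in terms of
the 2-form, with `E` and `B` bilinear in `(u, F)`.  What remains is to rewrite `∂𝔢/∂u` and `∂𝔢/∂F`
(`semFaraday_toFaraday`), for which two expressions for `⋆(X · F)` suffice:
`⋆(α ∧ i_v F) = i_{(i_v F)♯} i_{α♯} μ` (`hodge_act`), and
`⋆(X · F) = α(v) ⋆F - X† · ⋆F` with the metric adjoint `X† = α♯ ⊗ v♭` (`hodge_act_adjoint`).
The second one yields `B♯ ⊗^tr (∂ε/∂B)♭` (`trTensor_sharpForm_flatVec`).  The Poynting form comes from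
covariance, of which only the reflection in the hyperplane `u^⊥` is needed: it fixes `g`, `E` and `B`,
so `∂ε/∂B` vanishes on all forms `u♭ ∧ i_u χ` (`pairing_act_eq_zero`).  Taking `χ = i_y ⋆F` and
`X = u ⊗ u♭` in the two expressions for `⋆(X · F)` gives
`∂ε/∂B : i_y ⋆F = (1/c) g(u,y) ∂ε/∂B : B + S_ε(y)` (`pairing_interior_hodge`).
-/

noncomputable section

namespace EMFluid

/-! ### The action of rank-one endomorphisms on forms -/

section Fibre
variable {V : Type*} [AddCommGroup V] [Module ℝ V] [TopologicalSpace V]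

theorem wedge_apply {k : ℕ} (α : Fin k → Covec V) (x : Fin k → V) :
    wedge α x = (Matrix.of fun b a => α a (x b)).det := rfl

theorem act_apply {k : ℕ} (X : V →L[ℝ] V) (ω : Form V k) (x : Fin k → V) :
    act X ω x = ∑ j, ω (Function.update x j (X (x j))) := rfl

/-- Moving the `j`-th argument of a form to the front. -/
theorem form_update {k : ℕ} (ω : Form V (k + 1)) (x : Fin (k + 1) → V) (j : Fin (k + 1)) (v : V) :
    ω (Function.update x j v) =
      (-1) ^ (j : ℕ) * ω (Matrix.vecCons v fun a => x (j.succAbove a)) := by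
  have h := ω.toAlternatingMap.map_insertNth j v (j.removeNth x)
  rw [Fin.insertNth_removeNth, zsmul_eq_mul, Int.cast_pow, Int.cast_neg, Int.cast_one] at h
  exact h

/-- The expansion of a form in components, for any resolution `∑ᵢ φⁱ ⊗ fᵢ` of the identity. -/
theorem sum_smul_wedge {ι : Type*} [Fintype ι] {f : ι → V} {φ : ι → Covec V}
    (h : ∀ x, ∑ i, φ i x • f i = x) {k : ℕ} (ω : Form V k) :
    (k.factorial : ℝ)⁻¹ • ∑ i : Fin k → ι, ω (fun a => f (i a)) • wedge (fun a => φ (i a)) = ω := by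
  ext x
  have hx : ω x = ∑ i : Fin k → ι, (∏ a, φ (i a) (x a)) * ω (fun a => f (i a)) := by
    conv_lhs => rw [show x = fun a => ∑ i, φ i (x a) • f i from funext fun a => (h (x a)).symm]
    refine (ω.toMultilinearMap.map_sum fun a i => φ i (x a) • f i).trans ?_
    refine Finset.sum_congr rfl fun i _ => ?_
    exact ω.toMultilinearMap.map_smul_univ (fun a => φ (i a) (x a)) fun a => f (i a)
  -- each permutation in the determinant contributes `ω x`, after reindexing the components
  have key (σ : Equiv.Perm (Fin k)) :
      ∑ i : Fin k → ι, ω (fun a => f (i a)) *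
        (((Equiv.Perm.sign σ : ℤ) : ℝ) * ∏ a, φ (i a) (x (σ a))) = ω x := by
    rw [hx, ← Equiv.sum_comp (Equiv.arrowCongr σ.symm (Equiv.refl ι))]
    refine Finset.sum_congr rfl fun i _ => ?_
    have h2 : ω (fun a => f (i (σ a))) =
        ((Equiv.Perm.sign σ : ℤ) : ℝ) * ω (fun a => f (i a)) := by
      have h1 := ω.toAlternatingMap.map_perm (fun a => f (i a)) σ
      rw [Units.smul_def, zsmul_eq_mul] at h1
      exact h1
    have h3 : ∏ a, φ (i (σ a)) (x (σ a)) = ∏ a, φ (i a) (x a) :=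
      Equiv.prod_comp σ fun a => φ (i a) (x a)
    have h4 : ((Equiv.Perm.sign σ : ℤ) : ℝ) * ((Equiv.Perm.sign σ : ℤ) : ℝ) = 1 := by
      rw [← Int.cast_mul, Int.units_coe_mul_self, Int.cast_one]
    change ω (fun a => f (i (σ a))) *
      (((Equiv.Perm.sign σ : ℤ) : ℝ) * ∏ a, φ (i (σ a)) (x (σ a))) = _
    rw [h2, h3]
    linear_combination ((∏ a, φ (i a) (x a)) * ω (fun a => f (i a))) * h4
  simp only [ContinuousAlternatingMap.smul_apply, ContinuousAlternatingMap.sum_apply, smul_eq_mul,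
    wedge_apply, Matrix.det_apply', Matrix.of_apply, Finset.mul_sum (ι := Equiv.Perm (Fin k))]
  rw [Finset.sum_comm]
  simp_rw [key]
  rw [Finset.sum_const, Finset.card_univ, Fintype.card_perm, Fintype.card_fin, nsmul_eq_mul,
    inv_mul_cancel_left₀ (by positivity)]

theorem interior_interior_self {k : ℕ} (v : V) (ω : Form V (k + 2)) :
    interior v (interior v ω) = 0 := by
  ext x
  rw [interior_apply, interior_apply]
  exact ω.map_eq_zero_of_eq _ (i := 0) (j := 1) rfl (by simp)

theorem interior_add_form {k : ℕ} (v : V) (ω η : Form V (k + 1)) :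
    interior v (ω + η) = interior v ω + interior v η := rfl

theorem interior_smul_form {k : ℕ} (r : ℝ) (v : V) (ω : Form V (k + 1)) :
    interior v (r • ω) = r • interior v ω := rfl

theorem interior_add_left {k : ℕ} (v v' : V) (ω : Form V (k + 1)) :
    interior (v + v') ω = interior v ω + interior v' ω := by
  ext x
  exact ω.map_vecCons_add x v v'

theorem interior_smul_left {k : ℕ} (r : ℝ) (v : V) (ω : Form V (k + 1)) :
    interior (r • v) ω = r • interior v ω := by
  ext x
  exact ω.map_vecCons_smul x r v

theorem interior_comm {k : ℕ} (v v' : V) (ω : Form V (k + 2)) :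
    interior v (interior v' ω) = -interior v' (interior v ω) := by
  have h := interior_interior_self (v + v') ω
  simp only [interior_add_left, interior_add_form, interior_interior_self, zero_add, add_zero] at h
  exact eq_neg_of_add_eq_zero_right h

variable [ContinuousSMul ℝ V]

theorem act_rankOne_apply {k : ℕ} (α : Covec V) (v : V) (ω : Form V k) (x : Fin k → V) :
    act (α.smulRight v) ω x = ∑ j, α (x j) * ω (Function.update x j v) := by
  rw [act_apply]
  refine Finset.sum_congr rfl fun j _ => ?_
  exact ω.map_update_smul x j (α (x j)) v

/-- `X · ω = α ∧ i_v ω` for `X = v ⊗ α`, the wedge product being expanded in components. -/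
theorem sum_smul_wedge_vecCons {ι : Type*} [Fintype ι] {f : ι → V} {φ : ι → Covec V}
    (h : ∀ x, ∑ i, φ i x • f i = x) {k : ℕ} (ω : Form V (k + 1)) (α : Covec V) (v : V) :
    (k.factorial : ℝ)⁻¹ • ∑ i : Fin k → ι, ω (Matrix.vecCons v fun a => f (i a)) •
      wedge (Matrix.vecCons α fun a => φ (i a)) = act (α.smulRight v) ω := by
  ext x
  have hw (i : Fin k → ι) : wedge (Matrix.vecCons α fun a => φ (i a)) x =
      ∑ j : Fin (k + 1), (-1) ^ (j : ℕ) * α (x j) *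
        wedge (fun a => φ (i a)) (fun a => x (j.succAbove a)) := by
    rw [wedge_apply, Matrix.det_succ_column_zero]
    refine Finset.sum_congr rfl fun j _ => ?_
    rfl
  rw [act_rankOne_apply]
  simp only [ContinuousAlternatingMap.smul_apply, ContinuousAlternatingMap.sum_apply, smul_eq_mul,
    hw, Finset.mul_sum (ι := Fin (k + 1))]
  rw [Finset.sum_comm, Finset.mul_sum]
  refine Finset.sum_congr rfl fun j _ => ?_
  have hj := congrArg (fun η : Form V k => η fun a => x (j.succAbove a))
    (sum_smul_wedge h (interior v ω))
  simp only [ContinuousAlternatingMap.smul_apply, ContinuousAlternatingMap.sum_apply, smul_eq_mul,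
    interior_apply] at hj
  rw [form_update, ← hj, Finset.mul_sum, Finset.mul_sum, Finset.mul_sum, Finset.mul_sum]
  refine Finset.sum_congr rfl fun i _ => ?_
  ring

theorem interior_act {k : ℕ} (α : Covec V) (v y : V) (ω : Form V (k + 1)) :
    interior y (act (α.smulRight v) ω) =
      α y • interior v ω + act (α.smulRight v) (interior y ω) := by
  ext x
  rw [interior_apply, act_rankOne_apply, Fin.sum_univ_succ, ContinuousAlternatingMap.add_apply,
    act_rankOne_apply]
  congr 1
  · simp [interior_apply, Matrix.vecCons]
  · refine Finset.sum_congr rfl fun j _ => ?_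
    simp [interior_apply, Matrix.vecCons, Fin.cons_update]

/-- Pull-back of a form by `1 + X`, where `X = v ⊗ α`; terms of higher order in `X` vanish because
`X` has rank one. -/
theorem form_shear {k : ℕ} (α : Covec V) (v : V) (ω : Form V k) (x : Fin k → V) :
    ω (fun a => x a + α (x a) • v) = ω x + act (α.smulRight v) ω x := by
  induction k with
  | zero =>
    rw [act_apply, Finset.univ_eq_empty, Finset.sum_empty, add_zero]
    exact congrArg ω (Subsingleton.elim _ _)
  | succ k ih =>
    obtain ⟨y, x, rfl⟩ : ∃ y x', x = Matrix.vecCons y x' :=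
      ⟨x 0, Fin.tail x, (Fin.cons_self_tail x).symm⟩
    have h0 : (fun a => Matrix.vecCons y x a + α (Matrix.vecCons y x a) • v) =
        Matrix.vecCons (y + α y • v) fun a => x a + α (x a) • v := by
      funext a
      refine Fin.cases ?_ (fun a => ?_) a <;> simp
    have h1 := ih (interior (y + α y • v) ω) x
    rw [h0, ← interior_apply, h1, ← interior_apply, ← interior_apply, interior_act]
    have h2 : act (α.smulRight v) (interior v ω) x = 0 := by
      rw [act_rankOne_apply]
      refine Finset.sum_eq_zero fun j _ => ?_
      rw [interior_apply, ω.map_eq_zero_of_eq _ (i := 0) (j := j.succ) (by simp)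
        (Fin.succ_ne_zero j).symm, mul_zero]
    have h3 : act (α.smulRight v) (interior (y + α y • v) ω) x =
        act (α.smulRight v) (interior y ω) x := by
      have : act (α.smulRight v) (interior (y + α y • v) ω) x =
        act (α.smulRight v) (interior y ω) x + α y * act (α.smulRight v) (interior v ω) x := by
        simp only [act_rankOne_apply, interior_add_left, interior_smul_left,
          ContinuousAlternatingMap.add_apply, ContinuousAlternatingMap.smul_apply, smul_eq_mul,
          mul_add, Finset.sum_add_distrib, Finset.mul_sum]
        congr 1
        exact Finset.sum_congr rfl fun j _ => by ring
      rw [this, h2, mul_zero, add_zero]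
    rw [h3, interior_add_left, interior_smul_left]
    simp only [ContinuousAlternatingMap.add_apply, ContinuousAlternatingMap.smul_apply, smul_eq_mul]
    ring

theorem act_covec {A : Covec V} (α : Covec V) (v : V) : A.comp (α.smulRight v) = A v • α := by
  ext x
  simp [mul_comm]

/-- An endomorphism of rank one acts on top-degree forms by its trace `α(v)`. -/
theorem act_top {d : ℕ} (e : Module.Basis (Fin d) ℝ V) (α : Covec V) (v : V) (ω : Form V d) :
    act (α.smulRight v) ω = α v • ω := by
  have key (b : Module.Basis (Fin d) ℝ V) : act (α.smulRight v) ω b = α v * ω b := by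
    have hj (j : Fin d) : ω (Function.update b j v) = b.repr v j * ω b := by
      conv_lhs => rw [← b.sum_repr v]
      refine (ω.toMultilinearMap.map_update_sum _ _ _ _).trans ?_
      change ∑ l, ω (Function.update b j (b.repr v l • b l)) = _
      rw [Finset.sum_eq_single j]
      · rw [ω.map_update_smul, Function.update_eq_self, smul_eq_mul]
      · intro l _ hl
        have h0 : ω (Function.update b j (b l)) = 0 :=
          ω.toAlternatingMap.map_update_self b hl.symm
        rw [ω.map_update_smul, h0, smul_zero]
      · simp
    have hv : α v = ∑ j, b.repr v j * α (b j) := by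
      conv_lhs => rw [← b.sum_repr v]
      rw [map_sum]
      exact Finset.sum_congr rfl fun j _ => by rw [map_smul, smul_eq_mul]
    rw [act_rankOne_apply, hv, Finset.sum_mul]
    exact Finset.sum_congr rfl fun j _ => by rw [hj]; ring
  apply ContinuousAlternatingMap.toAlternatingMap_injective
  refine Module.Basis.ext_alternating e fun i hi => ?_
  have h := key (e.reindex (Equiv.ofBijective i (Finite.injective_iff_bijective.1 hi)).symm)
  rw [show ⇑(e.reindex (Equiv.ofBijective i (Finite.injective_iff_bijective.1 hi)).symm) =
    fun a => e (i a) from funext fun a => by simp] at h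
  exact h

end Fibre

/-! ### Musical isomorphisms and the Hodge star of 2-forms -/

section Fibre
variable {V : Type*} [AddCommGroup V] [Module ℝ V] [TopologicalSpace V]

/-- The interior product as a bilinear map. -/
def interiorBilin (k : ℕ) : V →ₗ[ℝ] Form V (k + 1) →ₗ[ℝ] Form V k :=
  LinearMap.mk₂ ℝ interior interior_add_left interior_smul_left
    (fun _ _ _ => rfl) fun _ _ _ => rfl

theorem interiorBilin_apply {k : ℕ} (v : V) (ω : Form V (k + 1)) :
    interiorBilin k v ω = interior v ω := rfl

/-- The infinitesimal action of `X` as a linear map on forms. -/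
def actLin {k : ℕ} (X : V →L[ℝ] V) : Form V k →ₗ[ℝ] Form V k where
  toFun := act X
  map_add' ω η := by
    ext x
    simp [act_apply, Finset.sum_add_distrib]
  map_smul' r ω := by
    ext x
    simp [act_apply, Finset.mul_sum]

theorem actLin_apply {k : ℕ} (X : V →L[ℝ] V) (ω : Form V k) : actLin X ω = act X ω := rfl

theorem append_update {X : Type*} {k l : ℕ} (y : Fin k → X) (x : Fin l → X) (i : Fin l) (c : X) :
    Fin.append y (Function.update x i c) =
      Function.update (Fin.append y x) (Fin.natAdd k i) c := by
  funext j
  refine Fin.addCases (fun j => ?_) (fun j => ?_) j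
  · rw [Fin.append_left, Function.update_of_ne (by simp [Fin.ext_iff]; omega), Fin.append_left]
  · simp only [Fin.append_right, Function.update_apply, Fin.natAdd_inj]

/-- The form `x ↦ μ(y₁, …, y_k, x₁, …, x_l)`. -/
def appendForm {k l d : ℕ} (h : k + l = d) (μ : Form V d) (y : Fin k → V) : Form V l where
  toFun x := μ fun a => Fin.append y x (Fin.cast h.symm a)
  map_update_add' := by
    subst h
    intro inst x i a b
    obtain rfl : inst = instDecidableEqFin l := Subsingleton.elim _ _
    simp only [Fin.cast_refl, id, append_update]
    exact μ.map_update_add _ _ _ _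
  map_update_smul' := by
    subst h
    intro inst x i a b
    obtain rfl : inst = instDecidableEqFin l := Subsingleton.elim _ _
    simp only [Fin.cast_refl, id, append_update]
    exact μ.map_update_smul _ _ _ _
  map_eq_zero_of_eq' := by
    subst h
    intro x a b hab hne
    refine μ.map_eq_zero_of_eq _ (i := Fin.natAdd k a) (j := Fin.natAdd k b) (by simp [hab]) ?_
    simpa using hne
  cont := by
    refine μ.cont.comp (continuous_pi fun a => ?_)
    generalize Fin.cast h.symm a = a'
    refine Fin.addCases (fun i => ?_) (fun i => ?_) a'
    · simpa using continuous_const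
    · simpa using continuous_apply i

theorem appendForm_apply {k l d : ℕ} (h : k + l = d) (μ : Form V d) (y : Fin k → V)
    (x : Fin l → V) :
    appendForm h μ y x = μ fun a => Fin.append y x (Fin.cast h.symm a) := rfl

theorem appendForm_two {l : ℕ} (h : 2 + l = l + 2) (μ : Form V (l + 2)) (y : Fin 2 → V) :
    appendForm h μ y = interior (y 1) (interior (y 0) μ) := by
  ext x
  rw [appendForm_apply, interior_apply, interior_apply]
  congr 1
  funext a
  refine Fin.cases ?_ (fun a => Fin.cases ?_ (fun a => ?_) a) a
  · exact Fin.append_left y x 0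
  · exact Fin.append_left y x 1
  · have : Fin.cast h.symm a.succ.succ = Fin.natAdd 2 a := by
      ext; simp; omega
    rw [this, Fin.append_right]
    rfl

/-- Cycling the last argument of a form to the front. -/
theorem form_snoc {k : ℕ} (ω : Form V (k + 1)) (x : Fin k → V) (v : V) :
    ω (Fin.snoc (α := fun _ => V) x v) = (-1) ^ k * interior v ω x := by
  have h := form_update ω (Fin.snoc (α := fun _ => V) x v) (Fin.last k) v
  rw [Fin.update_snoc_last] at h
  simpa [interior_apply] using h

/-- Moving three arguments of a form past `m` others costs the sign `(-1)^{3m} = (-1)^m`. -/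
theorem form_append_three {m : ℕ} (h : m + 3 = m + 3) (μ : Form V (m + 3)) (x : Fin m → V)
    (y : Fin 3 → V) :
    μ (fun a => Fin.append x y (Fin.cast h.symm a)) =
      (-1) ^ m * interior (y 2) (interior (y 1) (interior (y 0) μ)) x := by
  have e : (fun a => Fin.append x y (Fin.cast h.symm a)) = Fin.snoc (α := fun _ => V)
      (Fin.snoc (α := fun _ => V) (Fin.snoc (α := fun _ => V) x (y 0)) (y 1)) (y 2) := by
    funext a
    refine Fin.lastCases ?_ (fun a => Fin.lastCases ?_ (fun a => Fin.lastCases ?_ (fun a => ?_) a)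
      a) a
    · exact (Fin.append_right x y 2).trans (by rw [Fin.snoc_last])
    · exact (Fin.append_right x y 1).trans (by rw [Fin.snoc_castSucc, Fin.snoc_last])
    · exact (Fin.append_right x y 0).trans
        (by rw [Fin.snoc_castSucc, Fin.snoc_castSucc, Fin.snoc_last])
    · exact (Fin.append_left x y a).trans
        (by rw [Fin.snoc_castSucc, Fin.snoc_castSucc, Fin.snoc_castSucc])
  have hrev : interior (y 0) (interior (y 1) (interior (y 2) μ)) =
      -interior (y 2) (interior (y 1) (interior (y 0) μ)) := by
    have h1 (ω : Form V (m + 1)) : interior (y 1) (-ω) = -interior (y 1) ω := rfl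
    rw [interior_comm (y 0) (y 1), interior_comm (y 0) (y 2), interior_comm (y 2) (y 1)]
    exact congrArg Neg.neg (h1 _)
  have hsq : ((-1 : ℝ) ^ m) ^ 2 = 1 := by rw [← pow_mul, mul_comm, pow_mul]; simp
  rw [e, form_snoc, form_snoc, form_snoc, hrev, ContinuousAlternatingMap.neg_apply]
  linear_combination
    (-1) ^ m * interior (y 2) (interior (y 1) (interior (y 0) μ)) x * hsq

/-- The covector `i_v F` of a 2-form. -/
def contract (v : V) (F : Form V 2) : Covec V :=
  (ContinuousAlternatingMap.ofSubsingleton ℝ V ℝ (0 : Fin 1)).symm (interior v F)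

theorem contract_apply (v : V) (F : Form V 2) (x : V) : contract v F x = F ![v, x] := by
  rw [contract]
  change interior v F (fun _ => x) = _
  rw [interior_apply]
  congr 1
  funext a
  refine Fin.cases rfl (fun a => ?_) a
  rw [Subsingleton.elim a 0]
  rfl

theorem two_form_swap (F : Form V 2) (x y : V) : F ![x, y] = -F ![y, x] := by
  have h := form_update F ![x, y] 1 y
  have e1 : Function.update ![x, y] 1 y = ![x, y] := by
    funext a; fin_cases a <;> simp
  have e2 : (fun a => ![x, y] ((1 : Fin 2).succAbove a)) = ![x] := by
    funext a; fin_cases a; rfl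
  rw [e1, e2] at h
  simpa using h

variable [ContinuousSMul ℝ V]

theorem act_two_apply (α : Covec V) (v : V) (F : Form V 2) (x y : V) :
    act (α.smulRight v) F ![x, y] = α x * contract v F y - α y * contract v F x := by
  rw [act_rankOne_apply, Fin.sum_univ_two, contract_apply, contract_apply]
  have e1 : Function.update ![x, y] 0 v = ![v, y] := by
    funext a; fin_cases a <;> simp
  have e2 : Function.update ![x, y] 1 v = ![x, v] := by
    funext a; fin_cases a <;> simp
  rw [e1, e2, two_form_swap F x v]
  simp
  ring

variable [IsTopologicalAddGroup V] [T2Space V] [FiniteDimensional ℝ V]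

theorem isLorentzian_isInvertible {g : Bilin V} (hg : IsLorentzian g) : g.IsInvertible := by
  obtain ⟨hs, t, ht, hp⟩ := hg
  have hinj : Function.Injective (g : V →ₗ[ℝ] Covec V) := by
    rw [← LinearMap.ker_eq_bot, LinearMap.ker_eq_bot']
    intro v hv
    by_contra hne
    have hv' (w : V) : g v w = 0 := by
      have := congrArg (fun f : Covec V => f w) hv
      simpa using this
    have := hp v (by rw [hs, hv']) hne
    rw [hv'] at this
    exact lt_irrefl _ this
  have hfin : Module.finrank ℝ V = Module.finrank ℝ (Covec V) := by
    rw [← LinearEquiv.finrank_eq (LinearMap.toContinuousLinearMap : (V →ₗ[ℝ] ℝ) ≃ₗ[ℝ] V →L[ℝ] ℝ)]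
    exact (Subspace.dual_finrank_eq (K := ℝ) (V := V)).symm
  refine ⟨(LinearEquiv.ofInjectiveOfFinrankEq (g : V →ₗ[ℝ] Covec V) hinj
    hfin).toContinuousLinearEquiv, ?_⟩
  ext v w
  rfl

theorem apply_sharp {g : Bilin V} (hg : IsLorentzian g) (α : Covec V) : g (sharp g α) = α :=
  (isLorentzian_isInvertible hg).self_apply_inverse α

theorem sharp_apply {g : Bilin V} (hg : IsLorentzian g) (v : V) : sharp g (g v) = v :=
  (isLorentzian_isInvertible hg).inverse_apply_self v

theorem apply_sharp_comm {g : Bilin V} (hg : IsLorentzian g) (α β : Covec V) :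
    α (sharp g β) = β (sharp g α) := by
  conv_lhs => rw [← apply_sharp hg α]
  conv_rhs => rw [← apply_sharp hg β]
  exact hg.1 _ _

theorem frame_resolution (x : V) : ∑ i, dualVec (frame V) i x • frame V i = x :=
  (frame V).sum_repr x

theorem sharp_frame_resolution {g : Bilin V} (hg : IsLorentzian g) (x : V) :
    ∑ i, g (frame V i) x • sharp g (dualVec (frame V) i) = x := by
  have h : ∑ i, g (frame V i) x • dualVec (frame V) i = g x := by
    ext y
    conv_rhs => rw [← frame_resolution y]
    simp only [sum_apply, smul_apply, smul_eq_mul, map_sum,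
      map_smul]
    exact Finset.sum_congr rfl fun i _ => by rw [hg.1 x, mul_comm]
  conv_rhs => rw [← sharp_apply hg x, ← h, map_sum]
  exact Finset.sum_congr rfl fun i _ => by rw [map_smul]

theorem sum_apply_sharp_smul_frame {g : Bilin V} (hg : IsLorentzian g) (α : Covec V) :
    ∑ i, α (sharp g (dualVec (frame V) i)) • frame V i = sharp g α := by
  simp_rw [apply_sharp_comm hg α]
  exact frame_resolution _

theorem hodge_apply {k l d : ℕ} (h : k + l = d) (g : Bilin V) (μ : Form V d) (ω : Form V k)
    (x : Fin l → V) :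
    hodge h g μ ω x = (k.factorial : ℝ)⁻¹ * ∑ i : Fin k → Fin (Module.finrank ℝ V),
      ω (fun a => sharp g (dualVec (frame V) (i a))) *
        μ (fun a => Fin.append (fun b => frame V (i b)) x (Fin.cast h.symm a)) := by
  have key (i : Fin k → Fin (Module.finrank ℝ V)) := congrArg (fun η : Form V l => η x)
    (sum_smul_wedge frame_resolution (appendForm h μ fun b => frame V (i b)))
  simp only [ContinuousAlternatingMap.smul_apply, ContinuousAlternatingMap.sum_apply, smul_eq_mul,
    appendForm_apply] at key
  simp only [hodge, ContinuousAlternatingMap.smul_apply, ContinuousAlternatingMap.sum_apply,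
    smul_eq_mul]
  rw [mul_assoc, Finset.mul_sum]
  congr 1
  refine Finset.sum_congr rfl fun i _ => ?_
  rw [← key i, Finset.mul_sum, Finset.mul_sum, Finset.mul_sum]
  exact Finset.sum_congr rfl fun j _ => by ring

theorem hodge_two {l : ℕ} (h : 2 + l = l + 2) (g : Bilin V) (μ : Form V (l + 2)) (F : Form V 2) :
    hodge h g μ F = (2 : ℝ)⁻¹ • ∑ i, ∑ j,
      F ![sharp g (dualVec (frame V) i), sharp g (dualVec (frame V) j)] •
        interior (frame V j) (interior (frame V i) μ) := by
  ext x
  rw [hodge_apply]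
  simp only [ContinuousAlternatingMap.smul_apply, ContinuousAlternatingMap.sum_apply, smul_eq_mul]
  rw [← Equiv.sum_comp (finTwoArrowEquiv _).symm, Fintype.sum_prod_type]
  rw [show ((Nat.factorial 2 : ℕ) : ℝ) = 2 by norm_num [Nat.factorial]]
  congr 1
  · refine Finset.sum_congr rfl fun i _ => Finset.sum_congr rfl fun j _ => ?_
    have := congrArg (fun η : Form V l => η x) (appendForm_two h μ
      fun b => frame V ((finTwoArrowEquiv (Fin (Module.finrank ℝ V))).symm (i, j) b))
    simp only [appendForm_apply] at this
    rw [this]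
    congr 2
    funext a
    refine Fin.cases ?_ (fun a => ?_) a
    · rfl
    · rw [Subsingleton.elim a 0]
      rfl

/-- `⋆(α ∧ i_v F) = i_{(i_v F)♯} i_{α♯} μ`. -/
theorem hodge_act {l : ℕ} (h : 2 + l = l + 2) {g : Bilin V} (hg : IsLorentzian g)
    (μ : Form V (l + 2)) (F : Form V 2) (α : Covec V) (v : V) :
    hodge h g μ (act (α.smulRight v) F) =
      interior (sharp g (contract v F)) (interior (sharp g α) μ) := by
  have hb (β γ : Covec V) : ∑ i, ∑ j,
      (β (sharp g (dualVec (frame V) i)) * γ (sharp g (dualVec (frame V) j))) •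
        interior (frame V j) (interior (frame V i) μ) =
      interior (sharp g γ) (interior (sharp g β) μ) := by
    rw [← sum_apply_sharp_smul_frame hg β, ← sum_apply_sharp_smul_frame hg γ]
    simp only [← interiorBilin_apply, map_sum, map_smul, LinearMap.sum_apply, LinearMap.smul_apply,
      Finset.smul_sum, mul_smul]
  have h1 := hb α (contract v F)
  have h2 := hb (contract v F) α
  rw [interior_comm] at h2
  rw [hodge_two]
  ext x
  have h1x := congrArg (fun η : Form V l => η x) h1
  have h2x := congrArg (fun η : Form V l => η x) h2
  simp only [ContinuousAlternatingMap.smul_apply, ContinuousAlternatingMap.sum_apply, smul_eq_mul,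
    ContinuousAlternatingMap.neg_apply] at h1x h2x ⊢
  simp only [act_two_apply, sub_mul, Finset.sum_sub_distrib]
  have h3 := h2x
  simp only [mul_comm (contract v F _)] at h3
  rw [h1x, h3]
  ring

/-- The Hodge star turns the action of `X = v ⊗ α` on 2-forms into that of minus its metric adjoint
`α♯ ⊗ v♭`, up to the trace `α(v)` by which `X` acts on the volume form. -/
theorem hodge_act_adjoint {l : ℕ} (h : 2 + l = l + 2) {g : Bilin V} (hg : IsLorentzian g)
    (e : Module.Basis (Fin (l + 2)) ℝ V) (μ : Form V (l + 2)) (F : Form V 2) (α : Covec V) (v : V) :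
    hodge h g μ (act (α.smulRight v) F) =
      α v • hodge h g μ F - act ((g v).smulRight (sharp g α)) (hodge h g μ F) := by
  have hv : ∑ i, (g v (frame V i)) • sharp g (dualVec (frame V) i) = v := by
    conv_rhs => rw [← sharp_frame_resolution hg v]
    exact Finset.sum_congr rfl fun i _ => by rw [hg.1]
  have hF (w : V) : ∑ i, g v (frame V i) * F ![sharp g (dualVec (frame V) i), w] =
      contract v F w := by
    have h0 (y : V) : F ![y, w] = -contract w F y := by rw [contract_apply, two_form_swap]
    have h1 := congrArg (contract w F) hv
    simp only [map_sum, map_smul, smul_eq_mul] at h1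
    rw [contract_apply, h0, ← h1]
    simp only [h0, mul_neg, Finset.sum_neg_distrib]
  -- the trace of the adjoint `α♯ ⊗ v♭` is `g(v, α♯) = α(v)`
  have hα : α v • μ = act ((g v).smulRight (sharp g α)) μ := by
    rw [act_top e, hg.1, apply_sharp hg]
  have hint (i j) :
      interior (frame V j) (interior (frame V i) (α v • μ)) =
      g v (frame V i) • interior (frame V j) (interior (sharp g α) μ) +
      g v (frame V j) • interior (sharp g α) (interior (frame V i) μ) +
      act ((g v).smulRight (sharp g α)) (interior (frame V j) (interior (frame V i) μ)) := by
    rw [hα, interior_act, interior_add_form, interior_smul_form, interior_act]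
    exact (add_assoc _ _ _).symm
  have hactsum : act ((g v).smulRight (sharp g α)) (hodge h g μ F) = (2 : ℝ)⁻¹ • ∑ i, ∑ j,
      F ![sharp g (dualVec (frame V) i), sharp g (dualVec (frame V) j)] •
        act ((g v).smulRight (sharp g α)) (interior (frame V j) (interior (frame V i) μ)) := by
    simp only [hodge_two, ← actLin_apply, map_sum, map_smul]
  rw [hodge_act h hg, hactsum, hodge_two]
  ext x
  have hp : ∑ j, contract v F (sharp g (dualVec (frame V) j)) *
      interior (frame V j) (interior (sharp g α) μ) x =
      interior (sharp g (contract v F)) (interior (sharp g α) μ) x := by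
    have h1 : interior (sharp g (contract v F)) (interior (sharp g α) μ) =
        ∑ j, contract v F (sharp g (dualVec (frame V) j)) •
          interior (frame V j) (interior (sharp g α) μ) := by
      rw [← sum_apply_sharp_smul_frame hg (contract v F)]
      simp only [← interiorBilin_apply, map_sum, map_smul, LinearMap.sum_apply,
        LinearMap.smul_apply]
    rw [h1]
    simp
  have hint' (i j) : α v * interior (frame V j) (interior (frame V i) μ) x =
      g v (frame V i) * interior (frame V j) (interior (sharp g α) μ) x -
      g v (frame V j) * interior (frame V i) (interior (sharp g α) μ) x +
      act ((g v).smulRight (sharp g α)) (interior (frame V j) (interior (frame V i) μ)) x := by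
    have h1 := congrArg (fun η : Form V l => η x) (hint i j)
    rw [interior_comm (sharp g α)] at h1
    have h2 : interior (frame V j) (interior (frame V i) (α v • μ)) x =
      α v * interior (frame V j) (interior (frame V i) μ) x := rfl
    simp only [ContinuousAlternatingMap.add_apply, ContinuousAlternatingMap.smul_apply,
      ContinuousAlternatingMap.neg_apply, smul_eq_mul, h2] at h1
    rw [h1]
    ring
  simp only [ContinuousAlternatingMap.smul_apply, ContinuousAlternatingMap.sum_apply, smul_eq_mul,
    ContinuousAlternatingMap.sub_apply]
  have hS1 : ∑ i, ∑ j, F ![sharp g (dualVec (frame V) i), sharp g (dualVec (frame V) j)] *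
      (g v (frame V i) * interior (frame V j) (interior (sharp g α) μ) x) =
      interior (sharp g (contract v F)) (interior (sharp g α) μ) x := by
    rw [Finset.sum_comm, ← hp]
    refine Finset.sum_congr rfl fun j _ => ?_
    rw [← hF, Finset.sum_mul]
    exact Finset.sum_congr rfl fun i _ => by ring
  have hS2 : ∑ i, ∑ j, F ![sharp g (dualVec (frame V) i), sharp g (dualVec (frame V) j)] *
      (g v (frame V j) * interior (frame V i) (interior (sharp g α) μ) x) =
      -interior (sharp g (contract v F)) (interior (sharp g α) μ) x := by
    rw [← hp, ← Finset.sum_neg_distrib]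
    refine Finset.sum_congr rfl fun i _ => ?_
    rw [← hF, Finset.sum_mul, ← Finset.sum_neg_distrib]
    exact Finset.sum_congr rfl fun j _ => by rw [two_form_swap F]; ring
  have hsum : ∑ i, ∑ j, F ![sharp g (dualVec (frame V) i), sharp g (dualVec (frame V) j)] *
      (α v * interior (frame V j) (interior (frame V i) μ) x) =
      2 * interior (sharp g (contract v F)) (interior (sharp g α) μ) x +
      ∑ i, ∑ j, F ![sharp g (dualVec (frame V) i), sharp g (dualVec (frame V) j)] *
        act ((g v).smulRight (sharp g α)) (interior (frame V j) (interior (frame V i) μ)) x := by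
    simp only [hint', mul_add, mul_sub, Finset.sum_add_distrib, Finset.sum_sub_distrib]
    rw [hS1, hS2]
    ring
  have hpull : α v * ∑ i, ∑ j, F ![sharp g (dualVec (frame V) i), sharp g (dualVec (frame V) j)] *
      interior (frame V j) (interior (frame V i) μ) x =
      ∑ i, ∑ j, F ![sharp g (dualVec (frame V) i), sharp g (dualVec (frame V) j)] *
      (α v * interior (frame V j) (interior (frame V i) μ) x) := by
    simp only [Finset.mul_sum]
    exact Finset.sum_congr rfl fun i _ => Finset.sum_congr rfl fun j _ => by ring
  linear_combination (-2⁻¹ : ℝ) * hsum - 2⁻¹ * hpull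

end Fibre

/-! ### Pairings of forms and multivectors, volume forms -/

section Fibre
variable {V : Type*} [AddCommGroup V] [Module ℝ V] [TopologicalSpace V]

theorem wedge_comp_comm {g : Bilin V} (hg : IsLorentzian g) {k : ℕ} (x y : Fin k → V) :
    wedge (fun a => g (x a)) y = wedge (fun a => g (y a)) x := by
  rw [wedge_apply, wedge_apply, ← Matrix.det_transpose]
  congr 1
  ext a b
  exact hg.1 _ _

theorem top_form_ext {d : ℕ} (e : Module.Basis (Fin d) ℝ V) (ω η : Form V d) (h : ω e = η e) :
    ω = η := by
  apply ContinuousAlternatingMap.toAlternatingMap_injective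
  rw [AlternatingMap.eq_smul_basis_det e ω.toAlternatingMap,
    AlternatingMap.eq_smul_basis_det e η.toAlternatingMap]
  exact congrArg (· • e.det) h

theorem top_form_ne_zero {d : ℕ} (e : Module.Basis (Fin d) ℝ V) {μ : Form V d} (hμ : μ ≠ 0) :
    μ e ≠ 0 := fun h => hμ (top_form_ext e μ 0 h)

theorem topRatio_eq {d : ℕ} (e : Module.Basis (Fin d) ℝ V) {μ : Form V d} (hμ : μ ≠ 0)
    (ϱ : Form V d) : topRatio ϱ μ = (μ e)⁻¹ * ϱ e := by
  have hne := top_form_ne_zero e hμ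
  have h : ∃ r : ℝ, ϱ = r • μ := by
    refine ⟨(μ e)⁻¹ * ϱ e, top_form_ext e _ _ ?_⟩
    rw [ContinuousAlternatingMap.smul_apply, smul_eq_mul]
    field_simp
  rw [topRatio, dif_pos h]
  have h1 := congrArg (fun η : Form V d => η e) h.choose_spec
  simp only [ContinuousAlternatingMap.smul_apply, smul_eq_mul] at h1
  field_simp
  exact h1.symm

variable [IsTopologicalAddGroup V] [ContinuousSMul ℝ V] [T2Space V] [FiniteDimensional ℝ V]

theorem trTensor_eq_act {W : Type*} [AddCommGroup W] [Module ℝ W]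
    {k : ℕ} (π : Form V k →ₗ[ℝ] W) (ω : Form V k) (α : Covec V) (v : V) :
    trTensor π ω α v = π (act (α.smulRight v) ω) := by
  cases k with
  | zero =>
    have : act (α.smulRight v) ω = 0 := by
      ext x
      rw [act_apply, Finset.univ_eq_empty, Finset.sum_empty]
      rfl
    rw [this, map_zero]
    rfl
  | succ k =>
    rw [← sum_smul_wedge_vecCons frame_resolution ω α v]
    simp only [trTensor, map_smul, map_sum]

theorem flatVec_apply {g : Bilin V} (hg : IsLorentzian g) {k : ℕ} (π : Form V k →ₗ[ℝ] ℝ)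
    (x : Fin k → V) : flatVec g π x = π (wedge fun a => g (x a)) := by
  have h : (k.factorial : ℝ)⁻¹ • ∑ i : Fin k → Fin (Module.finrank ℝ V),
      wedge (fun a => dualVec (frame V) (i a)) x • wedge (fun a => g (frame V (i a))) =
      wedge fun a => g (x a) := by
    ext y
    rw [wedge_comp_comm hg, ← sum_smul_wedge frame_resolution (wedge fun a => g (y a))]
    simp only [ContinuousAlternatingMap.smul_apply, ContinuousAlternatingMap.sum_apply, smul_eq_mul]
    congr 1
    exact Finset.sum_congr rfl fun i _ => by rw [wedge_comp_comm hg, mul_comm]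
  rw [← h, flatVec]
  simp only [ContinuousAlternatingMap.smul_apply, ContinuousAlternatingMap.sum_apply, smul_eq_mul,
    map_smul, map_sum]
  congr 1
  exact Finset.sum_congr rfl fun i _ => mul_comm _ _

theorem sharpForm_wedge {g : Bilin V} (hg : IsLorentzian g) {k : ℕ} (ω : Form V k)
    (β : Fin k → Covec V) : sharpForm g ω (wedge β) = ω fun a => sharp g (β a) := by
  conv_rhs => rw [← sum_smul_wedge (sharp_frame_resolution hg) ω]
  rw [sharpForm]
  simp only [ContinuousAlternatingMap.smul_apply, ContinuousAlternatingMap.sum_apply, smul_eq_mul]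
  congr 1
  refine Finset.sum_congr rfl fun i _ => ?_
  have h : wedge β = wedge fun a => g (sharp g (β a)) := by simp only [apply_sharp hg]
  rw [h, wedge_comp_comm hg]

/-- `B♯ ⊗^tr b♭` paired with `α` and `v` is `b : (v♭ ∧ i_{α♯} B)`. -/
theorem trTensor_sharpForm_flatVec {g : Bilin V} (hg : IsLorentzian g) {k : ℕ}
    (b : Form V k →ₗ[ℝ] ℝ) (B : Form V k) (α : Covec V) (v : V) :
    trTensor (sharpForm g B) (flatVec g b) α v = b (act ((g v).smulRight (sharp g α)) B) := by
  cases k with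
  | zero =>
    have : act ((g v).smulRight (sharp g α)) B = 0 := by
      ext x
      rw [act_apply, Finset.univ_eq_empty, Finset.sum_empty]
      rfl
    rw [this, map_zero]
    rfl
  | succ k =>
    rw [← sum_smul_wedge_vecCons (sharp_frame_resolution hg) B]
    simp only [trTensor, map_smul, map_sum, smul_eq_mul]
    congr 1
    refine Finset.sum_congr rfl fun i _ => ?_
    rw [flatVec_apply hg, sharpForm_wedge hg, mul_comm]
    congr 2
    · funext a
      refine Fin.cases rfl (fun a => rfl) a
    · congr 1
      funext a
      refine Fin.cases rfl (fun a => rfl) a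

/-- `⋆(b♭)` is the form `y ↦ (-1)^m b : μ(y₁, y₂, y₃, ·)`; the sign `(-1)^{3m}` comes from moving
the three arguments past the `m` contracted ones. -/
theorem hodge_flatVec_apply {g : Bilin V} (hg : IsLorentzian g) {m : ℕ} (h : m + 3 = m + 3)
    (μ : Form V (m + 3)) (b : Form V m →ₗ[ℝ] ℝ) (y : Fin 3 → V) :
    hodge h g μ (flatVec g b) y =
      (-1) ^ m * b (interior (y 2) (interior (y 1) (interior (y 0) μ))) := by
  rw [← sum_smul_wedge frame_resolution (interior (y 2) (interior (y 1) (interior (y 0) μ))),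
    hodge_apply]
  simp only [flatVec_apply hg, apply_sharp hg, form_append_three, map_smul, map_sum, smul_eq_mul,
    Finset.mul_sum]
  exact Finset.sum_congr rfl fun i _ => by ring

theorem poynting_apply {g : Bilin V} (hg : IsLorentzian g) {m : ℕ} (c : ℝ) (μ : Form V (m + 3))
    (u : V) (E : Covec V) (b : Form V m →ₗ[ℝ] ℝ) (v : V) :
    poynting c g μ u E b v =
      1 / c * b (interior v (interior (sharp g E) (interior u μ))) := by
  have h : poynting c g μ u E b v = (-1 : ℝ) ^ (m + 2) * (1 / c) *
      hodge (k := m) (l := 3) rfl g μ (flatVec g b) ![u, sharp g E, v] := by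
    have hs (ω : Form V 1) :
        (ContinuousAlternatingMap.ofSubsingleton ℝ V ℝ (0 : Fin 1)).symm ω v = ω fun _ => v := rfl
    rw [poynting, smul_apply, smul_eq_mul, hs, interior_apply, interior_apply]
    congr 2
    funext a
    refine Fin.cases rfl (fun a => Fin.cases rfl (fun a => ?_) a) a
    rw [Subsingleton.elim a 0]
    rfl
  rw [h, hodge_flatVec_apply hg]
  have hsq : ((-1 : ℝ) ^ m) ^ 2 = 1 := by rw [← pow_mul, mul_comm, pow_mul]; simp
  simp only [Matrix.cons_val_zero, Matrix.cons_val_one, Matrix.cons_val]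
  linear_combination (1 / c * b (interior v (interior (sharp g E) (interior u μ)))) * hsq

theorem wedge_dualVec_self {d : ℕ} (e : Module.Basis (Fin d) ℝ V) : wedge (dualVec e) e = 1 := by
  rw [wedge_apply]
  rw [← Matrix.det_one (n := Fin d) (R := ℝ)]
  congr 1
  ext i j
  simp [dualVec, Matrix.one_apply, Finsupp.single_apply]

theorem volForm_ne_zero {d : ℕ} [NeZero d] (hd : Module.finrank ℝ V = d) {g : Bilin V}
    (hg : IsLorentzian g) (o : Orientation ℝ V (Fin d)) : volForm g o ≠ 0 := by
  have h : ∃ e : Module.Basis (Fin d) ℝ V, e.orientation = o :=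
    ⟨o.someBasis (by simp [hd]), o.someBasis_orientation _⟩
  rw [volForm, dif_pos h]
  set e := h.choose
  have hdet : (Matrix.of fun i j => g (e i) (e j)).det ≠ 0 := by
    intro h0
    obtain ⟨x, hx, hx0⟩ := Matrix.exists_vecMul_eq_zero_iff.2 h0
    apply hx
    have hv : g (∑ i, x i • e i) = 0 := by
      ext y
      rw [← e.sum_repr y, map_sum, map_sum]
      refine Finset.sum_eq_zero fun j _ => ?_
      have := congrFun hx0 j
      simp only [Matrix.vecMul, dotProduct, Matrix.of_apply, Pi.zero_apply] at this
      simp [this]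
    have hv' : ∑ i, x i • e i = 0 := by
      rw [← sharp_apply hg (∑ i, x i • e i), hv, map_zero]
    funext i
    exact Fintype.linearIndependent_iff.1 e.linearIndependent x hv' i
  intro h0
  have h1 := congrArg (fun η : Form V d => η e) h0
  simp only [ContinuousAlternatingMap.smul_apply, wedge_dualVec_self, smul_eq_mul, mul_one]
    at h1
  exact (Real.sqrt_pos.2 (abs_pos.2 hdet)).ne' h1

end Fibre

/-! ### Energies depending on the velocity and the 2-form -/

section Normed
variable {V : Type*} [NormedAddCommGroup V] [NormedSpace ℝ V]

theorem speed_pos {g : Bilin V} {w : V} (hw : g w w < 0) : 0 < speed g w :=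
  Real.sqrt_pos.2 (by linarith)

theorem speed_sq {g : Bilin V} {w : V} (hw : g w w < 0) : speed g w ^ 2 = -g w w :=
  Real.sq_sqrt (by linarith)

theorem worldVel_sq {c : ℝ} {g : Bilin V} {w : V} (hc : 0 < c) (hw : g w w < 0) :
    g (worldVel c g w) (worldVel c g w) = -c ^ 2 := by
  have hσ := (speed_pos hw).ne'
  have h := speed_sq hw
  simp only [worldVel, map_smul, smul_apply, smul_eq_mul]
  field_simp
  rw [h]
  ring

theorem hasFDerivAt_speed {g : Bilin V} (hg : IsLorentzian g) {w : V} (hw : g w w < 0) :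
    HasFDerivAt (speed g) (-(speed g w)⁻¹ • g w) w := by
  have h1 : HasFDerivAt (fun w' => -(g w' w')) (-(2 : ℝ) • g w) w := by
    have := (g.hasFDerivAt (x := w)).clm_apply (hasFDerivAt_id w)
    refine this.neg.congr_fderiv ?_
    ext v
    simp [hg.1 v w]
    ring
  refine (h1.sqrt (by linarith)).congr_fderiv ?_
  ext v
  simp [speed]
  ring

theorem hasFDerivAt_worldVel (c : ℝ) {g : Bilin V} (hg : IsLorentzian g) {w : V} (hw : g w w < 0) :
    HasFDerivAt (worldVel c g) ((c / speed g w) • ContinuousLinearMap.id ℝ V +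
      ((c / speed g w ^ 3) • g w).smulRight w) w := by
  have hσ := (speed_pos hw).ne'
  have h1 := (((hasDerivAt_inv hσ).comp_hasFDerivAt w (hasFDerivAt_speed hg hw)).const_mul c).smul
    (hasFDerivAt_id w)
  refine h1.congr_fderiv ?_
  ext v
  simp [div_eq_mul_inv, smul_smul]
  congr 2
  field_simp

/-- The ratio `ϱ / μ` as a continuous linear function of `ϱ`, computed on a basis. -/
def ratioLin {d : ℕ} (e : Module.Basis (Fin d) ℝ V) (μ : Form V d) : Form V d →L[ℝ] ℝ :=
  (μ e)⁻¹ • ContinuousAlternatingMap.apply ℝ V ℝ e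

theorem proper_eq {d : ℕ} (e : Module.Basis (Fin d) ℝ V) {μ : Form V d} (hμ : μ ≠ 0) (c : ℝ)
    (g : Bilin V) (w : V) (ϱ : Form V d) :
    proper c g μ w ϱ = speed g w / c * ratioLin e μ ϱ := by
  rw [proper, topRatio_eq e hμ]
  rfl

theorem hasFDerivAt_proper_vel {d : ℕ} (μ : Form V d) (c : ℝ)
    {g : Bilin V} (hg : IsLorentzian g) {w : V} (hw : g w w < 0) (ϱ : Form V d) :
    HasFDerivAt (fun w' => proper c g μ w' ϱ) (-(proper c g μ w ϱ / speed g w ^ 2) • g w) w := by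
  have hσ := (speed_pos hw).ne'
  refine (((hasFDerivAt_speed hg hw).mul_const c⁻¹).mul_const (topRatio ϱ μ)).congr_fderiv ?_
  ext v
  simp [proper]
  field_simp

theorem eventually_timelike {g : Bilin V} {w : V} (hw : g w w < 0) :
    ∀ᶠ w' in nhds w, g w' w' < 0 :=
  ((g.continuous.clm_apply continuous_id).continuousAt.eventually_lt continuousAt_const hw)

section Faraday

variable {d : ℕ} {c q : ℝ} {g : Bilin V}
  {μ : Form V d} {ℓ : Lagr V d} {e : FaradayEnergy V} {A : Covec V} {F : Form V 2}
  {w : V} {ϱ ς : Form V d}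

theorem faraday_chain {X : Type*} [NormedAddCommGroup X] [NormedSpace ℝ X] {ρ s : X → ℝ}
    {u : X → V} {f : X → Form V 2} {x : X} {ρ' s' : X →L[ℝ] ℝ} {u' : X →L[ℝ] V}
    {f' : X →L[ℝ] Form V 2} {D : ℝ × ℝ × V × Form V 2 →L[ℝ] ℝ}
    (hD : HasFDerivAt (fun p : ℝ × ℝ × V × Form V 2 => e p.1 p.2.1 p.2.2.1 p.2.2.2 g) D
      (ρ x, s x, u x, f x))
    (hρ : HasFDerivAt ρ ρ' x) (hs : HasFDerivAt s s' x) (hu : HasFDerivAt u u' x)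
    (hf : HasFDerivAt f f' x) :
    HasFDerivAt (fun y => e (ρ y) (s y) (u y) (f y) g)
      (D.comp (ρ'.prod (s'.prod (u'.prod f')))) x :=
  HasFDerivAt.comp (g := fun p : ℝ × ℝ × V × Form V 2 => e p.1 p.2.1 p.2.2.1 p.2.2.2 g)
    (f := fun y => (ρ y, s y, u y, f y)) x hD (hρ.prodMk (hs.prodMk (hu.prodMk hf)))

theorem lagrDiff_of_faraday (b : Module.Basis (Fin d) ℝ V) (hg : IsLorentzian g)
    (hμ : μ ≠ 0) (hℓ : ExpressedByFaraday c q g μ ℓ e)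
    (hw : g w w < 0)
    (he : FaradayEnergyDiff e g (proper c g μ w ϱ) (proper c g μ w ς) (worldVel c g w) F) :
    LagrDiff ℓ A F w ϱ ς := by
  let P := Covec V × Form V 2 × V × Form V d × Form V d
  have hu : DifferentiableAt ℝ (fun p : P => worldVel c g p.2.2.1) (A, F, w, ϱ, ς) :=
    (hasFDerivAt_worldVel c hg hw).differentiableAt.comp (f := fun p : P => p.2.2.1)
      (A, F, w, ϱ, ς) (by fun_prop)
  have hσ : DifferentiableAt ℝ (fun p : P => speed g p.2.2.1) (A, F, w, ϱ, ς) :=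
    (hasFDerivAt_speed hg hw).differentiableAt.comp (f := fun p : P => p.2.2.1)
      (A, F, w, ϱ, ς) (by fun_prop)
  have hρ : DifferentiableAt ℝ (fun p : P => proper c g μ p.2.2.1 p.2.2.2.1) (A, F, w, ϱ, ς) := by
    simp only [proper_eq b hμ]
    fun_prop
  have hs : DifferentiableAt ℝ (fun p : P => proper c g μ p.2.2.1 p.2.2.2.2) (A, F, w, ϱ, ς) := by
    simp only [proper_eq b hμ]
    fun_prop
  have hcomp : DifferentiableAt ℝ (fun p : P => e (proper c g μ p.2.2.1 p.2.2.2.1)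
      (proper c g μ p.2.2.1 p.2.2.2.2) (worldVel c g p.2.2.1) p.2.1 g) (A, F, w, ϱ, ς) :=
    DifferentiableAt.comp (g := fun p : ℝ × ℝ × V × Form V 2 => e p.1 p.2.1 p.2.2.1 p.2.2.2 g)
      (f := fun p : P => (proper c g μ p.2.2.1 p.2.2.2.1, proper c g μ p.2.2.1 p.2.2.2.2,
        worldVel c g p.2.2.1, p.2.1)) (A, F, w, ϱ, ς) he
      (hρ.prodMk (hs.prodMk (hu.prodMk (by fun_prop))))
  have hA : DifferentiableAt ℝ (fun p : P => p.1 (worldVel c g p.2.2.1)) (A, F, w, ϱ, ς) :=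
    DifferentiableAt.clm_apply (by fun_prop) hu
  have hev : ∀ᶠ p : P in nhds (A, F, w, ϱ, ς), g p.2.2.1 p.2.2.1 < 0 :=
    Filter.Tendsto.eventually (f := fun p : P => p.2.2.1)
      (by exact Continuous.tendsto (by fun_prop) (A, F, w, ϱ, ς)) (eventually_timelike hw)
  refine DifferentiableAt.congr_of_eventuallyEq ?_
    (hev.mono fun p hp => hℓ p.1 p.2.1 p.2.2.1 p.2.2.2.1 p.2.2.2.2 hp)
  exact (hcomp.neg.smul_const μ).sub (((hρ.const_mul q).mul hA).smul_const μ)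

end Faraday

variable [FiniteDimensional ℝ V]

theorem sem_eq_semTransported {d : ℕ} (e : Module.Basis (Fin d) ℝ V) (ℓ : Lagr V d) (A : Covec V)
    (F : Form V 2) (w : V) (ϱ ς : Form V d) : sem ℓ A F w ϱ ς = semTransported ℓ A F w ϱ ς := by
  funext α v
  have hF := trTensor_eq_act (dF ℓ A F w ϱ ς).toLinearMap F α v
  simp only [ContinuousLinearMap.coe_coe] at hF
  simp only [sem, semTransported, act_top e, act_covec, map_smul, map_neg, hF,
    ContinuousLinearMap.smulRight_apply]
  ext x
  simp
  ring

instance finiteDimensionalForm (k : ℕ) : FiniteDimensional ℝ (Form V k) := by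
  have h : Submodule.span ℝ (Set.range fun i : Fin k → Fin (Module.finrank ℝ V) =>
      (wedge fun a => dualVec (frame V) (i a) : Form V k)) = ⊤ := by
    refine eq_top_iff.2 fun ω _ => ?_
    rw [← sum_smul_wedge frame_resolution ω]
    exact Submodule.smul_mem _ _ (Submodule.sum_mem _ fun i _ =>
      Submodule.smul_mem _ _ (Submodule.subset_span ⟨i, rfl⟩))
  exact Module.Finite.of_fg_top (h ▸ Submodule.fg_span (Set.finite_range _))

section Faraday

variable {d : ℕ} {c q : ℝ} {g : Bilin V}
  {μ : Form V d} {ℓ : Lagr V d} {e : FaradayEnergy V} {A : Covec V} {F : Form V 2}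
  {w : V} {ϱ ς : Form V d}

theorem sem_of_faraday (b : Module.Basis (Fin d) ℝ V) (hg : IsLorentzian g) (hμ : μ ≠ 0)
    (hc : 0 < c) (hℓ : ExpressedByFaraday c q g μ ℓ e) (hw : g w w < 0)
    (he : FaradayEnergyDiff e g (proper c g μ w ϱ) (proper c g μ w ς) (worldVel c g w) F) :
    sem ℓ A F w ϱ ς =
      semFaraday c g μ e (proper c g μ w ϱ) (proper c g μ w ς) (worldVel c g w) F := by
  have hσ := (speed_pos hw).ne'
  set ρ := proper c g μ w ϱ with hρ
  set s := proper c g μ w ς with hs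
  set u := worldVel c g w with hu
  set τ : Form V d →L[ℝ] ℝ := (speed g w / c) • ratioLin b μ
  have hτ (η : Form V d) : proper c g μ w η = τ η := proper_eq b hμ c g w η
  obtain ⟨D, hD⟩ := he
  have hDsum (x y : ℝ) (v : V) (f : Form V 2) :
      D (x, y, v, f) =
        x * D (1, 0, 0, 0) + y * D (0, 1, 0, 0) + D (0, 0, v, 0) + D (0, 0, 0, f) := by
    rw [← smul_eq_mul, ← smul_eq_mul, ← map_smul, ← map_smul, ← map_add, ← map_add, ← map_add]
    simp
  have hl (A' : Covec V) (F' : Form V 2) (ϱ' ς' : Form V d) : ℓ A' F' w ϱ' ς' =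
      (-(e (τ ϱ') (τ ς') u F' g) - q * τ ϱ' * A' u) • μ := by
    rw [hℓ A' F' w ϱ' ς' hw, hτ, hτ]
    exact (sub_smul _ _ _).symm
  have hρτ : ρ = τ ϱ := hτ ϱ
  have hsτ : s = τ ς := hτ ς
  -- the partial derivatives of the energy
  have eρ : deriv (fun ρ' => e ρ' s u F g) ρ = D (1, 0, 0, 0) := by
    have := faraday_chain (x := ρ) (e := e) (g := g) (ρ := fun ρ' => ρ') (s := fun _ => s)
      (u := fun _ => u) (f := fun _ => F) hD (hasFDerivAt_id ρ) (hasFDerivAt_const _ _)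
      (hasFDerivAt_const _ _) (hasFDerivAt_const _ _)
    rw [this.hasDerivAt.deriv]
    rfl
  have es : deriv (fun s' => e ρ s' u F g) s = D (0, 1, 0, 0) := by
    have := faraday_chain (x := s) (e := e) (g := g) (ρ := fun _ => ρ) (s := fun s' => s')
      (u := fun _ => u) (f := fun _ => F) hD (hasFDerivAt_const _ _) (hasFDerivAt_id s)
      (hasFDerivAt_const _ _) (hasFDerivAt_const _ _)
    rw [this.hasDerivAt.deriv]
    rfl
  have eu (v : V) : fderiv ℝ (fun u' => e ρ s u' F g) u v = D (0, 0, v, 0) := by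
    have := faraday_chain (x := u) (e := e) (g := g) (ρ := fun _ => ρ) (s := fun _ => s)
      (u := fun u' => u') (f := fun _ => F) hD (hasFDerivAt_const _ _) (hasFDerivAt_const _ _)
      (hasFDerivAt_id u) (hasFDerivAt_const _ _)
    rw [this.fderiv]
    rfl
  have eF : fderiv ℝ (fun F' => e ρ s u F' g) F =
      D.comp ((0 : Form V 2 →L[ℝ] ℝ).prod ((0 : Form V 2 →L[ℝ] ℝ).prod
        ((0 : Form V 2 →L[ℝ] V).prod (ContinuousLinearMap.id ℝ (Form V 2))))) := by
    have := faraday_chain (x := F) (e := e) (g := g) (ρ := fun _ => ρ) (s := fun _ => s)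
      (u := fun _ => u) (f := fun F' => F') hD (hasFDerivAt_const _ _) (hasFDerivAt_const _ _)
      (hasFDerivAt_const _ _) (hasFDerivAt_id F)
    rw [this.fderiv]
  -- the partial derivatives of the Lagrangian density
  have lA (a : Covec V) : dA ℓ A F w ϱ ς a = (-(q * ρ * a u)) • μ := by
    have h0 : (fun A' => ℓ A' F w ϱ ς) = fun A' : Covec V =>
        (-(e (τ ϱ) (τ ς) u F g) - q * τ ϱ * A' u) • μ := funext fun A' => hl A' F ϱ ς
    have h1 : HasFDerivAt (fun A' : Covec V => A' u) (ContinuousLinearMap.apply ℝ ℝ u) A :=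
      (ContinuousLinearMap.apply ℝ ℝ u).hasFDerivAt
    have h2 := ((h1.const_mul (q * τ ϱ)).const_sub (-(e (τ ϱ) (τ ς) u F g))).smul_const μ
    rw [dA, h0, h2.fderiv, hρτ]
    rfl
  have lF (f : Form V 2) : dF ℓ A F w ϱ ς f = (-D (0, 0, 0, f)) • μ := by
    have h0 : (fun F' => ℓ A F' w ϱ ς) = fun F' =>
        (-(e (τ ϱ) (τ ς) u F' g) - q * τ ϱ * A u) • μ := funext fun F' => hl A F' ϱ ς
    have h1 := faraday_chain (x := F) (e := e) (g := g) (ρ := fun _ => ρ) (s := fun _ => s)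
      (u := fun _ => u) (f := fun F' => F') hD (hasFDerivAt_const _ _) (hasFDerivAt_const _ _)
      (hasFDerivAt_const _ _) (hasFDerivAt_id F)
    rw [hρτ, hsτ] at h1
    have h2 := (h1.neg.sub_const (q * τ ϱ * A u)).smul_const μ
    rw [dF, h0]
    exact congrArg (fun T : Form V 2 →L[ℝ] Form V d => T f) h2.fderiv
  have lρ : dRho ℓ A F w ϱ ς ϱ = (-(ρ * D (1, 0, 0, 0)) - q * ρ * A u) • μ := by
    have h0 : (fun ϱ' => ℓ A F w ϱ' ς) = fun ϱ' =>
        (-(e (τ ϱ') (τ ς) u F g) - q * τ ϱ' * A u) • μ := funext fun ϱ' => hl A F ϱ' ς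
    rw [hρτ, hsτ] at hD
    have h1 := faraday_chain (x := ϱ) (e := e) (g := g) (ρ := τ) (s := fun _ => τ ς)
      (u := fun _ => u) (f := fun _ => F) hD τ.hasFDerivAt (hasFDerivAt_const _ _)
      (hasFDerivAt_const _ _) (hasFDerivAt_const _ _)
    have h2 := (h1.neg.sub ((τ.hasFDerivAt.const_mul q).mul_const (A u))).smul_const μ
    rw [dRho, h0]
    refine (congrArg (fun T : Form V d →L[ℝ] Form V d => T ϱ) h2.fderiv).trans ?_
    have h3 := hDsum (τ ϱ) 0 0 0
    have h4 : D (0, 0, 0, 0) = 0 := map_zero D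
    simp only [zero_mul, h4, add_zero] at h3
    rw [hρτ, ← h3]
    change (-D (τ ϱ, 0, 0, 0) - A u * (q * τ ϱ)) • μ = _
    rw [mul_comm (A u)]
  have ls : dSigma ℓ A F w ϱ ς ς = (-(s * D (0, 1, 0, 0))) • μ := by
    have h0 : (fun ς' => ℓ A F w ϱ ς') = fun ς' =>
        (-(e (τ ϱ) (τ ς') u F g) - q * τ ϱ * A u) • μ := funext fun ς' => hl A F ϱ ς'
    rw [hρτ, hsτ] at hD
    have h1 := faraday_chain (x := ς) (e := e) (g := g) (ρ := fun _ => τ ϱ) (s := τ)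
      (u := fun _ => u) (f := fun _ => F) hD (hasFDerivAt_const _ _) τ.hasFDerivAt
      (hasFDerivAt_const _ _) (hasFDerivAt_const _ _)
    have h2 := (h1.neg.sub_const (q * τ ϱ * A u)).smul_const μ
    rw [dSigma, h0]
    refine (congrArg (fun T : Form V d →L[ℝ] Form V d => T ς) h2.fderiv).trans ?_
    have h3 := hDsum 0 (τ ς) 0 0
    have h4 : D (0, 0, 0, 0) = 0 := map_zero D
    simp only [zero_mul, h4, add_zero, zero_add] at h3
    rw [hsτ, ← h3]
    rfl
  have lw (v : V) : dw ℓ A F w ϱ ς v =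
      (-(-(ρ / speed g w ^ 2) * g w v * D (1, 0, 0, 0) +
          -(s / speed g w ^ 2) * g w v * D (0, 1, 0, 0) +
          D (0, 0, (c / speed g w) • v + (c / speed g w ^ 3 * g w v) • w, 0)) -
        q * (ρ * A ((c / speed g w) • v + (c / speed g w ^ 3 * g w v) • w) +
          A u * (-(ρ / speed g w ^ 2) * g w v))) • μ := by
    have h0 : (fun w' => ℓ A F w' ϱ ς) =ᶠ[nhds w] fun w' =>
        (-(e (proper c g μ w' ϱ) (proper c g μ w' ς) (worldVel c g w') F g) -
          q * (proper c g μ w' ϱ * A (worldVel c g w'))) • μ :=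
      (eventually_timelike hw).mono fun w' hw' => by
        change ℓ A F w' ϱ ς = (_ - q * (_ * _)) • μ
        rw [hℓ A F w' ϱ ς hw', ← mul_assoc]
        exact (sub_smul _ _ _).symm
    have h1 := faraday_chain (x := w) (e := e) (g := g) (ρ := fun w' => proper c g μ w' ϱ)
      (s := fun w' => proper c g μ w' ς) (u := worldVel c g) (f := fun _ => F) hD
      (hasFDerivAt_proper_vel μ c hg hw ϱ) (hasFDerivAt_proper_vel μ c hg hw ς)
      (hasFDerivAt_worldVel c hg hw) (hasFDerivAt_const _ _)
    have h2 := (h1.neg.sub (((hasFDerivAt_proper_vel μ c hg hw ϱ).mul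
      (A.hasFDerivAt.comp w (hasFDerivAt_worldVel c hg hw))).const_mul q)).smul_const μ
    rw [dw, h0.fderiv_eq]
    refine (congrArg (fun T : V →L[ℝ] Form V d => T v) h2.fderiv).trans ?_
    have h3 := hDsum (-(ρ / speed g w ^ 2) * g w v) (-(s / speed g w ^ 2) * g w v)
      ((c / speed g w) • v + (c / speed g w ^ 3 * g w v) • w) 0
    have h4 : D (0, 0, 0, 0) = 0 := map_zero D
    rw [h4, add_zero] at h3
    rw [← h3]
    rfl
  have hwu : w = (speed g w / c) • u := by
    rw [hu, worldVel, smul_smul, div_mul_div_cancel₀ hc.ne', div_self hσ, one_smul]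
  rw [sem_eq_semTransported b]
  funext α v
  have hF := trTensor_eq_act (dF ℓ A F w ϱ ς).toLinearMap F α v
  have hF' := trTensor_eq_act (fderiv ℝ (fun F' => e ρ s u F' g) F).toLinearMap F α v
  simp only [ContinuousLinearMap.coe_coe] at hF hF'
  have eF' (f : Form V 2) : fderiv ℝ (fun F' => e ρ s u F' g) F f = D (0, 0, 0, f) := by
    rw [eF]
    rfl
  have hadd (x y : ℝ) (v v' : V) : D (0, 0, x • v + y • v', 0) =
      x * D (0, 0, v, 0) + y * D (0, 0, v', 0) := by
    rw [← smul_eq_mul, ← smul_eq_mul, ← map_smul, ← map_smul, ← map_add]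
    simp
  have hDw : D (0, 0, w, 0) = speed g w / c * D (0, 0, u, 0) := by
    conv_lhs => rw [hwu]
    simpa using hadd (speed g w / c) 0 u 0
  have hαw : α w = speed g w / c * α u := by
    conv_lhs => rw [hwu]
    simp
  have hAw : A w = speed g w / c * A u := by
    conv_lhs => rw [hwu]
    simp
  have hgw : g w v = speed g w / c * g u v := by
    conv_lhs => rw [hwu]
    simp
  simp only [semTransported, semFaraday, hF, hF', lA, lF, lρ, ls, lw, eρ, es, eu, eF', hl, hadd,
    proj]
  ext x
  simp only [ContinuousAlternatingMap.smul_apply, ContinuousAlternatingMap.add_apply,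
    ContinuousAlternatingMap.sub_apply, smul_eq_mul, map_add, map_smul, hDw, hαw, hAw, hgw, ← hρτ,
    ← hsτ]
  have hc' := hc.ne'
  field_simp
  ring

end Faraday

end Normed

/-! ### Energies depending on the electric and the magnetic field -/

section Fibre
variable {V : Type*} [AddCommGroup V] [Module ℝ V] [TopologicalSpace V]

/-- The contraction `(v, F) ↦ i_v F` of a 2-form as a bilinear map. -/
def contractBilin : V →ₗ[ℝ] Form V 2 →ₗ[ℝ] Covec V :=
  LinearMap.mk₂ ℝ contract
    (fun v v' F => by rw [contract, interior_add_left]; rfl)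
    (fun r v F => by rw [contract, interior_smul_left]; rfl)
    (fun _ _ _ => rfl) fun _ _ _ => rfl

theorem elec_eq (c : ℝ) (u : V) (F : Form V 2) : elec c u F = -(1 / c) • contract u F := rfl

theorem elec_self (c : ℝ) (u : V) (F : Form V 2) : elec c u F u = 0 := by
  have : contract u F u = 0 := by
    rw [contract_apply]
    exact F.map_eq_zero_of_eq _ (i := 0) (j := 1) rfl (by simp)
  rw [elec_eq, smul_apply, this, smul_zero]

theorem contract_act_two [ContinuousSMul ℝ V] (α : Covec V) (u v : V) (F : Form V 2) :
    contract u (act (α.smulRight v) F) = α u • contract v F - F ![v, u] • α := by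
  ext y
  rw [contract_apply, act_two_apply]
  simp [contract_apply, mul_comm]

/-- The electric field of the 2-form `α ∧ i_v F`. -/
theorem elec_act [ContinuousSMul ℝ V] (c : ℝ) (α : Covec V) (u v : V) (F : Form V 2) :
    elec c u (act (α.smulRight v) F) = α u • elec c v F + elec c u F v • α := by
  rw [elec_eq, elec_eq, elec_eq, contract_act_two, two_form_swap F v u, ← contract_apply u F v]
  ext y
  simp
  ring

theorem act_smul_left [ContinuousSMul ℝ V] {k : ℕ} (r : ℝ) (α : Covec V) (v : V) (ω : Form V k) :
    act ((r • α).smulRight v) ω = r • act (α.smulRight v) ω := by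
  ext x
  simp [act_rankOne_apply, Finset.mul_sum, mul_assoc]

variable [IsTopologicalAddGroup V] [ContinuousSMul ℝ V]

/-- The reflection `1 + (2/c²) u ⊗ u♭` in the hyperplane `u^⊥`, where `g(u,u) = -c²`. -/
def reflection {c : ℝ} (hc : c ≠ 0) {g : Bilin V} {u : V} (hu : g u u = -c ^ 2) : V ≃L[ℝ] V :=
  ContinuousLinearEquiv.equivOfInverse
    (ContinuousLinearMap.id ℝ V + ((2 / c ^ 2) • g u).smulRight u)
    (ContinuousLinearMap.id ℝ V + ((2 / c ^ 2) • g u).smulRight u)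
    (fun x => by
      simp [hu, add_assoc, ← add_smul]
      left
      field_simp
      ring)
    (fun x => by
      simp [hu, add_assoc, ← add_smul]
      left
      field_simp
      ring)

theorem reflection_apply {c : ℝ} (hc : c ≠ 0) {g : Bilin V} {u : V} (hu : g u u = -c ^ 2) (x : V) :
    reflection hc hu x = x + ((2 / c ^ 2) • g u) x • u := rfl

theorem pullBilin_reflection {c : ℝ} (hc : c ≠ 0) {g : Bilin V} (hg : IsLorentzian g) {u : V}
    (hu : g u u = -c ^ 2) : pullBilin (reflection hc hu : V →L[ℝ] V) g = g := by
  ext x y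
  rw [pullBilin_apply]
  simp [reflection_apply, hu, hg.1 x u]
  field_simp
  ring

theorem form_comp_reflection {c : ℝ} (hc : c ≠ 0) {g : Bilin V} {u : V} (hu : g u u = -c ^ 2)
    {k : ℕ} (ω : Form V k) :
    ω.compContinuousLinearMap (reflection hc hu : V →L[ℝ] V) =
      ω + (2 / c ^ 2) • act ((g u).smulRight u) ω := by
  ext x
  have h := form_shear ((2 / c ^ 2) • g u) u ω x
  rw [act_smul_left] at h
  exact h

variable [T2Space V] [FiniteDimensional ℝ V]

/-- The Hodge star as a linear map. -/
def hodgeLin {k l d : ℕ} (h : k + l = d) (g : Bilin V) (μ : Form V d) :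
    Form V k →ₗ[ℝ] Form V l where
  toFun := hodge h g μ
  map_add' ω η := by
    ext x
    simp [hodge_apply, add_mul, Finset.sum_add_distrib, mul_add]
  map_smul' r ω := by
    ext x
    simp only [hodge_apply, ContinuousAlternatingMap.smul_apply, smul_eq_mul, RingHom.id_apply,
      Finset.mul_sum]
    exact Finset.sum_congr rfl fun i _ => by ring

section Identity

variable {m : ℕ} {c : ℝ} {g : Bilin V} {μ : Form V (m + 3)} {u : V} {F : Form V 2}

theorem magn_eq (c : ℝ) (g : Bilin V) (μ : Form V (m + 3)) (u : V) (F : Form V 2)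
    (h : 2 + (m + 1) = m + 3) :
    magn c g μ u F = -(1 / c) • interior u (hodge h g μ F) := rfl

/-- `∂ε/∂B : i_y ⋆F` splits into a multiple of `∂ε/∂B : B` and the Poynting form, provided
`∂ε/∂B` annihilates the forms `u♭ ∧ i_u χ`. -/
theorem pairing_interior_hodge (e : Module.Basis (Fin (m + 3)) ℝ V) (hg : IsLorentzian g)
    (hc : c ≠ 0) (hu : g u u = -c ^ 2) (h : 2 + (m + 1) = m + 3) (b : Form V m →ₗ[ℝ] ℝ)
    (hb : ∀ χ, b (act ((g u).smulRight u) χ) = 0) (y : V) :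
    b (interior y (hodge h g μ F)) =
      1 / c * (g u y * b (magn c g μ u F)) + poynting c g μ u (elec c u F) b y := by
  set G := hodge h g μ F with hG
  have hE : contract u F = -c • elec c u F := by
    rw [elec_eq, smul_smul]
    field_simp
    simp
  -- the two expressions for `⋆(X · F)` with `X = u ⊗ u♭`, which is its own adjoint
  have h1 : hodge h g μ (act ((g u).smulRight u) F) =
      g u u • G - act ((g u).smulRight (sharp g (g u))) G := hodge_act_adjoint h hg e μ F (g u) u
  have h2 : hodge h g μ (act ((g u).smulRight u) F) =
      interior (sharp g (contract u F)) (interior (sharp g (g u)) μ) := hodge_act h hg μ F (g u) u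
  rw [h2, sharp_apply hg, hu, hE, map_smul, interior_smul_left] at h1
  have h3 : act ((g u).smulRight u) G =
      -c ^ 2 • G + c • interior (sharp g (elec c u F)) (interior u μ) := by
    ext x
    have := congrArg (fun η : Form V (m + 1) => η x) h1
    simp only [ContinuousAlternatingMap.smul_apply, ContinuousAlternatingMap.sub_apply,
      smul_eq_mul, ContinuousAlternatingMap.add_apply] at this ⊢
    linear_combination this
  have h4 := interior_act (g u) u y G
  rw [h3, interior_add_form, interior_smul_form, interior_smul_form] at h4
  have h5 := congrArg b h4
  rw [map_add, map_add, map_smul, map_smul, map_smul, hb] at h5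
  have h6 := poynting_apply hg c μ u (elec c u F) b y
  have h7 : b (magn c g μ u F) = -(1 / c) * b (interior u G) := by
    rw [magn_eq c g μ u F h, map_smul, smul_eq_mul]
  rw [h6, h7]
  simp only [smul_eq_mul] at h5
  field_simp
  linear_combination -h5

/-- The magnetic field of the 2-form `α ∧ i_v F`. -/
theorem magn_act (e : Module.Basis (Fin (m + 3)) ℝ V) (hg : IsLorentzian g)
    (h : 2 + (m + 1) = m + 3) (α : Covec V) (v : V) :
    magn c g μ u (act (α.smulRight v) F) = α v • magn c g μ u F +
      (1 / c * g u v) • interior (sharp g α) (hodge h g μ F) -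
      act ((g v).smulRight (sharp g α)) (magn c g μ u F) := by
  set G := hodge h g μ F with hG
  have h1 : hodge h g μ (act (α.smulRight v) F) =
      α v • G - act ((g v).smulRight (sharp g α)) G := hodge_act_adjoint h hg e μ F α v
  have h2 : interior u (hodge h g μ (act (α.smulRight v) F)) =
      α v • interior u G - (g v u • interior (sharp g α) G +
        act ((g v).smulRight (sharp g α)) (interior u G)) := by
    rw [h1, ← interior_act]
    rfl
  have h3 : act ((g v).smulRight (sharp g α)) (-(1 / c) • interior u G) =
      -(1 / c) • act ((g v).smulRight (sharp g α)) (interior u G) := map_smul (actLin _) _ _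
  rw [magn_eq c g μ u _ h, magn_eq c g μ u _ h, h2, ← hG, h3, hg.1 v u]
  ext x
  simp only [ContinuousAlternatingMap.smul_apply, ContinuousAlternatingMap.sub_apply,
      smul_eq_mul, ContinuousAlternatingMap.add_apply]
  ring

/-- The magnetic field has no component along the velocity. -/
theorem act_magn_self (c : ℝ) (g : Bilin V) (μ : Form V (m + 3)) (u : V) (F : Form V 2)
    (α : Covec V) : act (α.smulRight u) (magn c g μ u F) = 0 := by
  ext x
  rw [act_rankOne_apply]
  refine Finset.sum_eq_zero fun j _ => ?_
  have h : magn c g μ u F (Function.update x j u) = -(1 / c) *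
      hodge (k := 2) (l := m + 1) (by omega) g μ F (Matrix.vecCons u (Function.update x j u)) := rfl
  rw [h, ContinuousAlternatingMap.map_eq_zero_of_eq _ _ (i := 0) (j := j.succ) (by simp)
    (Fin.succ_ne_zero j).symm, mul_zero, mul_zero]

end Identity

end Fibre

section Normed
variable {V : Type*} [NormedAddCommGroup V] [NormedSpace ℝ V]

theorem energy_chain {m : ℕ} {g : Bilin V} {ε : Energy V m} {ρ s : ℝ} {X : Type*}
    [NormedAddCommGroup X] [NormedSpace ℝ X]
    {E : X → Covec V} {B : X → Form V m} {x : X} {E' : X →L[ℝ] Covec V}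
    {B' : X →L[ℝ] Form V m} {D : ℝ × ℝ × Covec V × Form V m →L[ℝ] ℝ}
    (hD : HasFDerivAt (fun p : ℝ × ℝ × Covec V × Form V m => ε p.1 p.2.1 p.2.2.1 p.2.2.2 g) D
      (ρ, s, E x, B x)) (hE : HasFDerivAt E E' x) (hB : HasFDerivAt B B' x) :
    HasFDerivAt (fun y => ε ρ s (E y) (B y) g)
      (D.comp ((0 : X →L[ℝ] ℝ).prod ((0 : X →L[ℝ] ℝ).prod (E'.prod B')))) x :=
  HasFDerivAt.comp (g := fun p : ℝ × ℝ × Covec V × Form V m => ε p.1 p.2.1 p.2.2.1 p.2.2.2 g)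
    (f := fun y => (ρ, s, E y, B y)) x hD ((hasFDerivAt_const _ _).prodMk
      ((hasFDerivAt_const _ _).prodMk (hE.prodMk hB)))

variable [FiniteDimensional ℝ V]

/-- The electric field as a continuous bilinear function of the velocity and the 2-form. -/
def elecBilin (c : ℝ) : V →L[ℝ] Form V 2 →L[ℝ] Covec V :=
  LinearMap.toContinuousBilinearMap (-(1 / c) • contractBilin)

/-- The magnetic field as a continuous bilinear function of the velocity and the 2-form. -/
def magnBilin {m : ℕ} (c : ℝ) (g : Bilin V) (μ : Form V (m + 3)) :
    V →L[ℝ] Form V 2 →L[ℝ] Form V m :=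
  LinearMap.toContinuousBilinearMap (-(1 / c) •
    (interiorBilin m).compl₂ (hodgeLin (k := 2) (l := m + 1) (by omega) g μ))

theorem hasFDerivAt_elec_vel (c : ℝ) (u : V) (F : Form V 2) :
    HasFDerivAt (fun u' => elec c u' F) ((elecBilin c).flip F) u :=
  ((elecBilin c).flip F).hasFDerivAt

theorem hasFDerivAt_elec_form (c : ℝ) (u : V) (F : Form V 2) :
    HasFDerivAt (fun F' => elec c u F') (elecBilin c u) F :=
  (elecBilin c u).hasFDerivAt

theorem hasFDerivAt_magn_vel {m : ℕ} (c : ℝ) (g : Bilin V) (μ : Form V (m + 3)) (u : V)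
    (F : Form V 2) : HasFDerivAt (fun u' => magn c g μ u' F) ((magnBilin c g μ).flip F) u :=
  ((magnBilin c g μ).flip F).hasFDerivAt

theorem hasFDerivAt_magn_form {m : ℕ} (c : ℝ) (g : Bilin V) (μ : Form V (m + 3)) (u : V)
    (F : Form V 2) : HasFDerivAt (fun F' => magn c g μ u F') (magnBilin c g μ u) F :=
  (magnBilin c g μ u).hasFDerivAt

section EnergyBranch

variable {m : ℕ} {c q : ℝ} {g : Bilin V} {μ : Form V (m + 3)} {ℓ : Lagr V (m + 3)}
  {ε : Energy V m} {A : Covec V} {F : Form V 2} {w u : V} {ϱ ς : Form V (m + 3)} {ρ s : ℝ}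

/-- An energy density in terms of the electric and the magnetic field as one in terms of the
velocity and the 2-form. -/
def Energy.toFaraday (c : ℝ) (g : Bilin V) (μ : Form V (m + 3)) (ε : Energy V m) :
    FaradayEnergy V :=
  fun ρ s u F g' => ε ρ s (elec c u F) (magn c g μ u F) g'

theorem faradayEnergyDiff_toFaraday
    (hε : EnergyDiff ε g ρ s (elec c u F) (magn c g μ u F)) :
    FaradayEnergyDiff (ε.toFaraday c g μ) g ρ s u F := by
  have h1 : DifferentiableAt ℝ (fun p : ℝ × ℝ × V × Form V 2 => elecBilin c p.2.2.1 p.2.2.2)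
      (ρ, s, u, F) := by fun_prop
  have h2 : DifferentiableAt ℝ (fun p : ℝ × ℝ × V × Form V 2 => magnBilin c g μ p.2.2.1 p.2.2.2)
      (ρ, s, u, F) := by fun_prop
  exact DifferentiableAt.comp
    (g := fun p : ℝ × ℝ × Covec V × Form V m => ε p.1 p.2.1 p.2.2.1 p.2.2.2 g)
    (f := fun p : ℝ × ℝ × V × Form V 2 =>
      (p.1, p.2.1, elecBilin c p.2.2.1 p.2.2.2, magnBilin c g μ p.2.2.1 p.2.2.2)) (ρ, s, u, F) hε
    (differentiableAt_fst.prodMk (DifferentiableAt.prodMk (by fun_prop) (h1.prodMk h2)))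

/-- Invariance of the energy under the reflection in `u^⊥`, which fixes the electric and the magnetic
field, makes `∂ε/∂B` annihilate the forms `u♭ ∧ i_u χ`. -/
theorem pairing_act_eq_zero (hc : c ≠ 0) (hg : IsLorentzian g) (hu : g u u = -c ^ 2)
    (hcov : ∀ L : V ≃L[ℝ] V, ∀ E B, ε ρ s (E.comp (L : V →L[ℝ] V))
      (B.compContinuousLinearMap (L : V →L[ℝ] V)) (pullBilin (L : V →L[ℝ] V) g) = ε ρ s E B g)
    (hd : DifferentiableAt ℝ (fun B' => ε ρ s (elec c u F) B' g) (magn c g μ u F)) (χ : Form V m) :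
    fderiv ℝ (fun B' => ε ρ s (elec c u F) B' g) (magn c g μ u F)
      (act ((g u).smulRight u) χ) = 0 := by
  set E := elec c u F
  set B := magn c g μ u F
  set f := fun B' => ε ρ s E B' g with hf
  have hE : E.comp (reflection hc hu : V →L[ℝ] V) = E := by
    ext x
    simp [reflection_apply, E, elec_self]
  set R : Form V m →L[ℝ] Form V m :=
    ContinuousAlternatingMap.compContinuousLinearMapCLM (reflection hc hu : V →L[ℝ] V)
  have hR (χ : Form V m) : R χ = χ + (2 / c ^ 2) • act ((g u).smulRight u) χ :=
    form_comp_reflection hc hu χ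
  have hRB : R B = B := by
    rw [hR, act_magn_self, smul_zero, add_zero]
  have hfR : f ∘ R = f := by
    funext χ
    have := hcov (reflection hc hu) E χ
    rw [hE, pullBilin_reflection hc hg] at this
    exact this
  have h1 : HasFDerivAt (f ∘ R) ((fderiv ℝ f B).comp R) B := by
    refine HasFDerivAt.comp B ?_ R.hasFDerivAt
    rw [hRB]
    exact hd.hasFDerivAt
  rw [hfR] at h1
  have h2 := congrArg (fun T : Form V m →L[ℝ] ℝ => T χ) (h1.unique hd.hasFDerivAt)
  simp only [ContinuousLinearMap.comp_apply, hR, map_add, map_smul, smul_eq_mul] at h2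
  have h3 : 2 / c ^ 2 * fderiv ℝ f B (act ((g u).smulRight u) χ) = 0 := by linarith
  exact (mul_eq_zero.1 h3).resolve_left (by positivity)

/-- For an energy invariant under the isometries of `g`, the stress-energy-momentum tensor written in
terms of the 2-form agrees with the one written in terms of the electric and the magnetic field. -/
theorem semFaraday_toFaraday (b : Module.Basis (Fin (m + 3)) ℝ V) (hc : c ≠ 0)
    (hg : IsLorentzian g) (hu : g u u = -c ^ 2)
    (hcov : ∀ L : V ≃L[ℝ] V, ∀ E B, ε ρ s (E.comp (L : V →L[ℝ] V))
      (B.compContinuousLinearMap (L : V →L[ℝ] V)) (pullBilin (L : V →L[ℝ] V) g) = ε ρ s E B g)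
    (hε : EnergyDiff ε g ρ s (elec c u F) (magn c g μ u F)) :
    semFaraday c g μ (ε.toFaraday c g μ) ρ s u F =
      semElecMagn c g μ ε ρ s u (elec c u F) (magn c g μ u F) := by
  obtain ⟨D, hD⟩ := hε
  have hED := energy_chain (E := fun E' => E') (B := fun _ => magn c g μ u F) (x := elec c u F) hD
    (hasFDerivAt_id _) (hasFDerivAt_const _ _)
  have hBD := energy_chain (E := fun _ => elec c u F) (B := fun B' => B') (x := magn c g μ u F) hD
    (hasFDerivAt_const _ _) (hasFDerivAt_id _)
  have hb := pairing_act_eq_zero hc hg hu hcov hBD.differentiableAt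
  set εE := fderiv ℝ (fun E' => ε ρ s E' (magn c g μ u F) g) (elec c u F) with hεE
  set εB := fderiv ℝ (fun B' => ε ρ s (elec c u F) B' g) (magn c g μ u F) with hεB
  have hDsum (E' : Covec V) (B' : Form V m) : D (0, 0, E', B') = εE E' + εB B' := by
    rw [hεE, hεB, hED.fderiv, hBD.fderiv]
    change _ = D (0, 0, E', 0) + D (0, 0, 0, B')
    rw [← map_add]
    simp
  have hu' (v : V) : fderiv ℝ (fun u' => ε.toFaraday c g μ ρ s u' F g) u v =
      εE (elec c v F) + εB (magn c g μ v F) := by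
    rw [← hDsum]
    exact congrArg (fun T : V →L[ℝ] ℝ => T v) (energy_chain (E := fun u' => elec c u' F)
      (B := fun u' => magn c g μ u' F) (x := u) hD (hasFDerivAt_elec_vel c u F)
      (hasFDerivAt_magn_vel c g μ u F)).fderiv
  have hF' (f : Form V 2) : fderiv ℝ (fun F' => ε.toFaraday c g μ ρ s u F' g) F f =
      εE (elec c u f) + εB (magn c g μ u f) := by
    rw [← hDsum]
    exact congrArg (fun T : Form V 2 →L[ℝ] ℝ => T f) (energy_chain (E := fun F' => elec c u F')
      (B := fun F' => magn c g μ u F') (x := F) hD (hasFDerivAt_elec_form c u F)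
      (hasFDerivAt_magn_form c g μ u F)).fderiv
  funext α v
  have h : 2 + (m + 1) = m + 3 := by omega
  have htr := trTensor_eq_act
    (fderiv ℝ (fun F' => ε.toFaraday c g μ ρ s u F' g) F).toLinearMap F α v
  have htr' := trTensor_sharpForm_flatVec hg εB.toLinearMap (magn c g μ u F) α v
  have hS (y : V) := pairing_interior_hodge (F := F) (μ := μ) b hg hc hu h εB.toLinearMap hb y
  have hSα : α (sharp g (poynting c g μ u (elec c u F) εB)) =
      poynting c g μ u (elec c u F) εB (sharp g α) := apply_sharp_comm hg _ _
  have hgα : g u (sharp g α) = α u := by rw [hg.1, apply_sharp hg]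
  have hmv : εB (magn c g μ v F) = -(1 / c) * εB (interior v (hodge h g μ F)) := by
    rw [magn_eq c g μ v F h, map_smul, smul_eq_mul]
  simp only [ContinuousLinearMap.coe_coe] at htr htr' hS
  rw [hF', elec_act, magn_act b hg h, map_add, map_smul, map_smul, map_sub, map_add, map_smul,
    map_smul] at htr
  simp only [smul_eq_mul] at htr
  have h1 := hS v
  have h2 := hS (sharp g α)
  rw [hgα] at h2
  rw [h2] at htr
  rw [h1] at hmv
  simp only [semFaraday, semElecMagn, htr, hu', hmv, proj]
  rw [← hεE, ← hεB, htr', hSα]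
  simp only [Energy.toFaraday]
  congr 1
  ring

theorem sem_of_energy (b : Module.Basis (Fin (m + 3)) ℝ V) (hg : IsLorentzian g) (hμ : μ ≠ 0)
    (hc : 0 < c) (hℓ : ExpressedByEnergy c q g μ ℓ ε) (hw : g w w < 0)
    (hcov : ∀ L : V ≃L[ℝ] V, ∀ ρ s E B, ε ρ s (E.comp (L : V →L[ℝ] V))
      (B.compContinuousLinearMap (L : V →L[ℝ] V)) (pullBilin (L : V →L[ℝ] V) g) = ε ρ s E B g)
    (hε : EnergyDiff ε g (proper c g μ w ϱ) (proper c g μ w ς) (elec c (worldVel c g w) F)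
      (magn c g μ (worldVel c g w) F)) :
    LagrDiff ℓ A F w ϱ ς ∧ sem ℓ A F w ϱ ς = semElecMagn c g μ ε (proper c g μ w ϱ)
      (proper c g μ w ς) (worldVel c g w) (elec c (worldVel c g w) F)
      (magn c g μ (worldVel c g w) F) := by
  have hℓ' : ExpressedByFaraday c q g μ ℓ (ε.toFaraday c g μ) := hℓ
  have hd := faradayEnergyDiff_toFaraday hε
  refine ⟨lagrDiff_of_faraday b hg hμ hℓ' hw hd, ?_⟩
  rw [sem_of_faraday b hg hμ hc hℓ' hw hd]
  exact semFaraday_toFaraday b hc.ne' hg (worldVel_sq hc hw) (fun L => hcov L _ _) hε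

end EnergyBranch

end Normed

end EMFluid

end

theorem mainTheorem4
    -- the dimension of space is `n = m + 2`, that of spacetime is `n + 1 = m + 3`
    (m : ℕ)
    {E : Type*} [NormedAddCommGroup E] [NormedSpace ℝ E] [FiniteDimensional ℝ E]
    (hE : Module.finrank ℝ E = m + 3)
    {M : Type*} [TopologicalSpace M] [ChartedSpace E M] [IsManifold 𝓘(ℝ, E) (⊤ : ℕ∞) M]
    (g : ∀ x : M, Bilin (TangentSpace 𝓘(ℝ, E) x)) (hg : ∀ x, IsLorentzian (g x))
    (o : ∀ x : M, Orientation ℝ (TangentSpace 𝓘(ℝ, E) x) (Fin (m + 3)))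
    (μ : ∀ x : M, Form (TangentSpace 𝓘(ℝ, E) x) (m + 3))
    (hμ : ∀ x, μ x = volForm (g x) (o x))
    (c : ℝ) (hc : 0 < c) (q : ℝ)
    -- the spacetime Lagrangian density, a bundle map
    (ℓ : ∀ x : M, Lagr (TangentSpace 𝓘(ℝ, E) x) (m + 3))
    -- the region occupied by the fluid and the fields on it
    (N : Set M)
    (A : ∀ x : M, Covec (TangentSpace 𝓘(ℝ, E) x))
    (F : ∀ x : M, Form (TangentSpace 𝓘(ℝ, E) x) 2)
    (w : ∀ x : M, TangentSpace 𝓘(ℝ, E) x) (hw : ∀ x ∈ N, g x (w x) (w x) < 0)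
    (ϱ ς : ∀ x : M, Form (TangentSpace 𝓘(ℝ, E) x) (m + 3))
    -- the world-velocity, the proper densities, the electric and the magnetic field
    (u : ∀ x : M, TangentSpace 𝓘(ℝ, E) x) (hu : ∀ x, u x = worldVel c (g x) (w x))
    (ρ s : M → ℝ) (hρ : ∀ x, ρ x = proper c (g x) (μ x) (w x) (ϱ x))
    (hs : ∀ x, s x = proper c (g x) (μ x) (w x) (ς x))
    (El : ∀ x : M, Covec (TangentSpace 𝓘(ℝ, E) x)) (hEl : ∀ x, El x = elec c (u x) (F x))
    (B : ∀ x : M, Form (TangentSpace 𝓘(ℝ, E) x) m)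
    (hB : ∀ x, B x = magn c (g x) (μ x) (u x) (F x)) :
    -- (i) transported variables
    (∀ x ∈ N, LagrDiff (ℓ x) (A x) (F x) (w x) (ϱ x) (ς x) →
      sem (ℓ x) (A x) (F x) (w x) (ϱ x) (ς x) =
        semTransported (ℓ x) (A x) (F x) (w x) (ϱ x) (ς x)) ∧
    -- (ii) electric and magnetic components
    (∀ ε : ∀ x : M, Energy (TangentSpace 𝓘(ℝ, E) x) m, IsCovariant ε →
      (∀ x ∈ N, ExpressedByEnergy c q (g x) (μ x) (ℓ x) (ε x)) →
      ∀ x ∈ N, EnergyDiff (ε x) (g x) (ρ x) (s x) (El x) (B x) →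
        LagrDiff (ℓ x) (A x) (F x) (w x) (ϱ x) (ς x) ∧
        sem (ℓ x) (A x) (F x) (w x) (ϱ x) (ς x) =
          semElecMagn c (g x) (μ x) (ε x) (ρ x) (s x) (u x) (El x) (B x)) ∧
    -- (iii) Faraday 2-form
    (∀ e : ∀ x : M, FaradayEnergy (TangentSpace 𝓘(ℝ, E) x),
      (∀ x ∈ N, ExpressedByFaraday c q (g x) (μ x) (ℓ x) (e x)) →
      ∀ x ∈ N, FaradayEnergyDiff (e x) (g x) (ρ x) (s x) (u x) (F x) →
        LagrDiff (ℓ x) (A x) (F x) (w x) (ϱ x) (ς x) ∧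
        sem (ℓ x) (A x) (F x) (w x) (ϱ x) (ς x) =
          semFaraday c (g x) (μ x) (e x) (ρ x) (s x) (u x) (F x)) := by
  -- the tangent spaces are the model space `E`, whose norm the calculus lemmas use
  have hvol (g' : Bilin E) (hg' : IsLorentzian g') (o' : Orientation ℝ E (Fin (m + 3))) :
      volForm g' o' ≠ 0 := volForm_ne_zero hE hg' o'
  have hne (x : M) : μ x ≠ 0 := by
    rw [hμ x]
    exact hvol (g x) (hg x) (o x)
  have b : Module.Basis (Fin (m + 3)) ℝ E :=
    (Module.finBasis ℝ E).reindex (finCongr hE)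
  obtain rfl : u = fun x => worldVel c (g x) (w x) := funext hu
  obtain rfl : ρ = fun x => proper c (g x) (μ x) (w x) (ϱ x) := funext hρ
  obtain rfl : s = fun x => proper c (g x) (μ x) (w x) (ς x) := funext hs
  obtain rfl : El = fun x => elec c (worldVel c (g x) (w x)) (F x) := funext hEl
  obtain rfl : B = fun x => magn c (g x) (μ x) (worldVel c (g x) (w x)) (F x) := funext hB
  refine ⟨fun x _ _ => ?_, fun ε hcov hℓ x hx hε => ?_, fun e hℓ x hx he => ⟨?_, ?_⟩⟩
  · exact sem_eq_semTransported (V := E) b (ℓ x) (A x) (F x) (w x) (ϱ x) (ς x)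
  · exact sem_of_energy (V := E) b (hg x) (hne x) hc (hℓ x hx) (hw x hx)
      (fun L ρ s e b => hcov x x L ρ s e b (g x) (hg x)) hε
  · exact lagrDiff_of_faraday (V := E) b (hg x) (hne x) (hℓ x hx) (hw x hx) he
  · exact sem_of_faraday (V := E) b (hg x) (hne x) hc (hℓ x hx) (hw x hx) he
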